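/- For $n\in\mathbb{N}$, $n\ge1$, let $\mathbb{P}_n$ be the set of positive definite complex $n\times n$ matrices, let $\lambda_n(C)$ denote the smallest eigenvalue of a Hermitian $n\times n$ matrix $C$, and let $\|\cdot\|_\infty$ denote the operator norm (with respect to the Euclidean norm on $\mathbb{C}^n$). Let $p,q,s$ be non-zero real numbers. (1) The following are equivalent: (i) for every $n\ge1$ the function $(A,B)\in\mathbb{P}_n\times\mathbb{P}_n\mapsto\lambda_n\bigl((A^{p/2}B^qA^{p/2})^s\bigr)$ is jointly concave; (ii) this function is jointly concave for $n=2$; (iii) either $0\le p,q\le1$ and $0<s\le 1/(p+q)$, or $-1\le p,q\le0$ and $1/(p+q)\le s<0$. (2) The following are equivalent: (i) for every $n\ge1$ the function $(A,B)\in\mathbb{P}_n\times\mathbb{P}_n\mapsto\bigl\|(A^{p/2}B^qA^{p/2})^s\bigr\|_\infty$ is jointly convex; (ii) this function is jointly convex for $n=2$; (iii) $(p,q,s)$, or $(-p,-q,-s)$ in place of $(p,q,s)$, satisfies one of the three conditions (a) $-1\le p,q\le0$ and $s>0$; (b) $-1\le p\le0$, $1\le q\le2$, $p+q>0$ and $s\ge1/(p+q)$;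 (c) $1\le p\le2$, $-1\le q\le0$, $p+q>0$ and $s\ge1/(p+q)$. -/

import Mathlib

open scoped MatrixOrder ComplexOrder

noncomputable section

/-- The pairs `(A, B)` of positive definite complex `n × n` matrices. -/
def posDefPairs (n : ℕ) : Set (Matrix (Fin n) (Fin n) ℂ × Matrix (Fin n) (Fin n) ℂ) :=
  {X | X.1.PosDef ∧ X.2.PosDef}

/-- `(A^{p/2} B^q A^{p/2})^s`, all real powers being taken in the functional calculus
of positive matrices. -/
def sandwichPower {n : ℕ} (p q s : ℝ) (A B : Matrix (Fin n) (Fin n) ℂ) :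
    Matrix (Fin n) (Fin n) ℂ :=
  (A ^ (p / 2) * B ^ q * A ^ (p / 2)) ^ s

/-- The smallest eigenvalue of a Hermitian matrix (see `isLeast_minEigenvalue`). -/
def minEigenvalue {n : ℕ} (M : Matrix (Fin n) (Fin n) ℂ) : ℝ :=
  sInf (spectrum ℝ M)

theorem isLeast_minEigenvalue {n : ℕ} (hn : 0 < n) {M : Matrix (Fin n) (Fin n) ℂ}
    (hM : M.IsHermitian) : IsLeast (Set.range hM.eigenvalues) (minEigenvalue M) := by
  have : Nonempty (Fin n) := ⟨⟨0, hn⟩⟩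
  rw [minEigenvalue, hM.spectrum_real_eq_range_eigenvalues]
  exact ⟨(Set.range_nonempty _).csInf_mem (Set.finite_range _),
    fun x hx => csInf_le (Set.finite_range _).bddBelow hx⟩

/-- The operator norm of a matrix acting on the Hilbert space `ℂⁿ`. -/
def opNorm {n : ℕ} (M : Matrix (Fin n) (Fin n) ℂ) : ℝ :=
  ‖Matrix.toEuclideanCLM (n := Fin n) (𝕜 := ℂ) M‖

/-- Joint concavity of `(A, B) ↦ λ_n ((A^{p/2} B^q A^{p/2})^s)` on pairs of positive definite
`n × n` matrices. -/
def JointlyConcaveMinEigenvalue (n : ℕ) (p q s : ℝ) : Prop :=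
  ConcaveOn ℝ (posDefPairs n) (fun X => minEigenvalue (sandwichPower p q s X.1 X.2))

/-- Joint convexity of `(A, B) ↦ ‖(A^{p/2} B^q A^{p/2})^s‖_∞` on pairs of positive definite
`n × n` matrices. -/
def JointlyConvexOpNorm (n : ℕ) (p q s : ℝ) : Prop :=
  ConvexOn ℝ (posDefPairs n) (fun X => opNorm (sandwichPower p q s X.1 X.2))

def ConcavityCondition (p q s : ℝ) : Prop :=
  (p ∈ Set.Icc 0 1 ∧ q ∈ Set.Icc 0 1 ∧ 0 < s ∧ s ≤ 1 / (p + q)) ∨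
  (p ∈ Set.Icc (-1) 0 ∧ q ∈ Set.Icc (-1) 0 ∧ 1 / (p + q) ≤ s ∧ s < 0)

/-- The three conditions for convexity with `s > 0`. -/
def PosConvexityCondition (p q s : ℝ) : Prop :=
  (p ∈ Set.Icc (-1) 0 ∧ q ∈ Set.Icc (-1) 0 ∧ 0 < s) ∨
  (p ∈ Set.Icc (-1) 0 ∧ q ∈ Set.Icc 1 2 ∧ 0 < p + q ∧ 1 / (p + q) ≤ s) ∨
  (p ∈ Set.Icc 1 2 ∧ q ∈ Set.Icc (-1) 0 ∧ 0 < p + q ∧ 1 / (p + q) ≤ s)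

def ConvexityCondition (p q s : ℝ) : Prop :=
  PosConvexityCondition p q s ∨ PosConvexityCondition (-p) (-q) (-s)

end

section

open scoped Matrix.Norms.L2Operator

variable {n : ℕ}

/-! Inverting `A^{p/2} B^q A^{p/2}` changes the signs of `p`, `q` and `s` together, so one may take
`s > 0`.

Sufficiency: conjugation by `A^{-p/2}` turns a lower bound `c` on the smallest eigenvalue into `c
A^{-p} ≤ B^q`, and an upper bound `c` on the norm into `B^q ≤ c A^{-p}`. The two variables are now
separated, and operator convexity of the smaller side together with operator concavity of the larger
one (`rpow_convex`, `rpow_concave`) makes the level condition at `1` stable under convex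
combinations. Both quantities are homogeneous of degree `p + q`, so their powers with exponent `1 /
(p + q)` are homogeneous of degree one, and for such functions one level set decides concavity or
convexity (`concaveOn_of_homogeneous`, `convexOn_of_homogeneous`). The remaining exponent `(p + q)
s` is handled by a scalar power function.

Necessity, in dimension two: scalar matrices restrict the signs and `(p + q) s`. Concavity of a
positive function on a cone forces monotonicity, and a suitable fixed `A` converts this into
operator monotonicity of `B ↦ B ^ q`, hence `q ≤ 1` (`le_one_of_rpow_monotone`); the analogous
argument for the norm with `q < 0` gives `-1 ≤ q`. For `q > 0`, letting `A^{p/2}` degenerate to a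
rank-one projection leaves convexity of a power of one diagonal entry of `B ^ q`
(`JointlyConvexOpNorm.entry_convex`), which explicit matrices refute outside `1 ≤ q ≤ 2`. -/

/-! ### Real powers of positive definite matrices. -/

theorem Matrix.PosDef.rpow {A : Matrix (Fin n) (Fin n) ℂ} (hA : A.PosDef) (r : ℝ) :
    (A ^ r).PosDef :=
  Matrix.isStrictlyPositive_iff_posDef.1
    (IsStrictlyPositive.rpow A r (Matrix.isStrictlyPositive_iff_posDef.2 hA))

theorem Matrix.PosDef.zero_le {A : Matrix (Fin n) (Fin n) ℂ} (hA : A.PosDef) : 0 ≤ A :=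
  Matrix.nonneg_iff_posSemidef.2 hA.posSemidef

theorem Matrix.PosDef.rpow_mul_rpow {A : Matrix (Fin n) (Fin n) ℂ} (hA : A.PosDef) (x y : ℝ) :
    A ^ x * A ^ y = A ^ (x + y) :=
  (CFC.rpow_add hA.isUnit).symm

theorem Matrix.PosDef.rpow_rpow {A : Matrix (Fin n) (Fin n) ℂ} (hA : A.PosDef) (x y : ℝ)
    (hx : x ≠ 0) : (A ^ x) ^ y = A ^ (x * y) :=
  CFC.rpow_rpow A x y hx (Matrix.isStrictlyPositive_iff_posDef.2 hA)

theorem Matrix.PosDef.rpow_mul_rpow_neg {A : Matrix (Fin n) (Fin n) ℂ} (hA : A.PosDef) (x : ℝ) :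
    A ^ x * A ^ (-x) = 1 := by
  rw [hA.rpow_mul_rpow, add_neg_cancel, CFC.rpow_zero A hA.zero_le]

theorem Matrix.PosDef.rpow_neg_mul_rpow {A : Matrix (Fin n) (Fin n) ℂ} (hA : A.PosDef) (x : ℝ) :
    A ^ (-x) * A ^ x = 1 := by
  rw [hA.rpow_mul_rpow, neg_add_cancel, CFC.rpow_zero A hA.zero_le]

theorem Matrix.PosDef.inv_rpow {A : Matrix (Fin n) (Fin n) ℂ} (hA : A.PosDef) (x : ℝ) :
    (A ^ x)⁻¹ = A ^ (-x) :=
  Matrix.inv_eq_right_inv (hA.rpow_mul_rpow_neg x)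

theorem Matrix.PosDef.rpow_neg_one {A : Matrix (Fin n) (Fin n) ℂ} (hA : A.PosDef) :
    A ^ (-1 : ℝ) = A⁻¹ := by
  rw [← hA.inv_rpow 1, CFC.rpow_one A hA.zero_le]

theorem Matrix.PosDef.smul_rpow {A : Matrix (Fin n) (Fin n) ℂ} (hA : A.PosDef) {t : ℝ}
    (ht : 0 < t) (r : ℝ) : (t • A) ^ r = t ^ r • A ^ r := by
  have hA' := hA.zero_le
  have hfin : (spectrum ℝ A).Finite := Set.toFinite _
  rw [CFC.rpow_eq_cfc_real (smul_nonneg ht.le hA'), CFC.rpow_eq_cfc_real hA',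
    ← cfc_comp_smul t (fun x : ℝ => x ^ r) A (Set.Finite.continuousOn (hfin.image _) _),
    ← cfc_smul (t ^ r) (fun x : ℝ => x ^ r) A (hfin.continuousOn _)]
  refine cfc_congr fun x hx => ?_
  simp [Real.mul_rpow ht.le (spectrum_nonneg_of_nonneg hA' hx)]

theorem conjugate_le_conjugate_iff {C D X Y : Matrix (Fin n) (Fin n) ℂ} (hC : C.IsHermitian)
    (hD : D.IsHermitian) (h1 : C * D = 1) (h2 : D * C = 1) :
    C * X * C ≤ C * Y * C ↔ X ≤ Y := by
  constructor
  · intro h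
    have := star_left_conjugate_le_conjugate h D
    have e (Z : Matrix (Fin n) (Fin n) ℂ) : star D * (C * Z * C) * D = Z := by
      rw [Matrix.star_eq_conjTranspose, hD.eq]
      simp only [← mul_assoc, h2, one_mul]
      rw [mul_assoc, h1, mul_one]
    rwa [e, e] at this
  · intro h
    have := star_left_conjugate_le_conjugate h C
    rwa [Matrix.star_eq_conjTranspose, hC.eq] at this

/-! ### The sandwiched product and its order bounds. -/

/-- `A^{p/2} B^q A^{p/2}`. -/
noncomputable def sandwich (p q : ℝ) (A B : Matrix (Fin n) (Fin n) ℂ) : Matrix (Fin n) (Fin n) ℂ :=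
  A ^ (p / 2) * B ^ q * A ^ (p / 2)

theorem sandwich_posDef (p q : ℝ) {A B : Matrix (Fin n) (Fin n) ℂ} (hA : A.PosDef)
    (hB : B.PosDef) : (sandwich p q A B).PosDef := by
  have h := (hA.rpow (p / 2))
  have := (hB.rpow q).conjTranspose_mul_mul_same (B := A ^ (p / 2))
    (Matrix.mulVec_injective_iff_isUnit.2 h.isUnit)
  rwa [h.isHermitian.eq] at this

theorem conj_rpow_neg (p c : ℝ) {A : Matrix (Fin n) (Fin n) ℂ} (hA : A.PosDef) :
    A ^ (p / 2) * (c • A ^ (-p)) * A ^ (p / 2) = c • 1 := by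
  rw [mul_smul_comm, smul_mul_assoc, hA.rpow_mul_rpow, hA.rpow_mul_rpow]
  ring_nf
  rw [CFC.rpow_zero A hA.zero_le]

/-- Conjugation by `A ^ (-p / 2)` preserves the order and moves every power of `A` to one side; this
separation of variables is what makes one-variable operator convexity applicable. -/
theorem smul_one_le_sandwich_iff (p q c : ℝ) {A B : Matrix (Fin n) (Fin n) ℂ} (hA : A.PosDef) :
    c • 1 ≤ sandwich p q A B ↔ c • A ^ (-p) ≤ B ^ q := by
  rw [sandwich, ← conj_rpow_neg p c hA]
  exact conjugate_le_conjugate_iff (hA.rpow _).isHermitian (hA.rpow _).isHermitian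
    (hA.rpow_mul_rpow_neg _) (hA.rpow_neg_mul_rpow _)

theorem sandwich_le_smul_one_iff (p q c : ℝ) {A B : Matrix (Fin n) (Fin n) ℂ} (hA : A.PosDef) :
    sandwich p q A B ≤ c • 1 ↔ B ^ q ≤ c • A ^ (-p) := by
  rw [sandwich, ← conj_rpow_neg p c hA]
  exact conjugate_le_conjugate_iff (hA.rpow _).isHermitian (hA.rpow _).isHermitian
    (hA.rpow_mul_rpow_neg _) (hA.rpow_neg_mul_rpow _)

theorem sandwich_inv (p q : ℝ) {A B : Matrix (Fin n) (Fin n) ℂ} (hA : A.PosDef) (hB : B.PosDef) :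
    (sandwich p q A B)⁻¹ = sandwich (-p) (-q) A B := by
  rw [sandwich, Matrix.mul_inv_rev, Matrix.mul_inv_rev, hA.inv_rpow, hB.inv_rpow, sandwich,
    neg_div, mul_assoc]

theorem sandwichPower_neg (p q s : ℝ) {A B : Matrix (Fin n) (Fin n) ℂ} (hA : A.PosDef)
    (hB : B.PosDef) : sandwichPower (-p) (-q) (-s) A B = sandwichPower p q s A B := by
  have h := sandwich_posDef p q hA hB
  change sandwich (-p) (-q) A B ^ (-s) = sandwich p q A B ^ s
  rw [← sandwich_inv p q hA hB, ← h.rpow_neg_one, h.rpow_rpow _ _ (by norm_num)]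
  simp

/-- The two products are similar through `A^{p/2} B^{q/2}`. This makes the problem symmetric in `p`
and `q`. -/
theorem spectrum_sandwich_comm (p q : ℝ) {A B : Matrix (Fin n) (Fin n) ℂ} (hA : A.PosDef)
    (hB : B.PosDef) : spectrum ℝ (sandwich q p B A) = spectrum ℝ (sandwich p q A B) := by
  let u : (Matrix (Fin n) (Fin n) ℂ)ˣ :=
    ⟨A ^ (p / 2) * B ^ (q / 2), B ^ (-(q / 2)) * A ^ (-(p / 2)), by
      rw [mul_assoc, ← mul_assoc (B ^ (q / 2)), hB.rpow_mul_rpow_neg, one_mul,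
        hA.rpow_mul_rpow_neg], by
      rw [mul_assoc, ← mul_assoc (A ^ (-(p / 2))), hA.rpow_neg_mul_rpow, one_mul,
        hB.rpow_neg_mul_rpow]⟩
  rw [← spectrum.units_conjugate (u := u)]
  congr 1
  rw [Units.mul_inv_eq_iff_eq_mul]
  simp only [u, sandwich]
  have hq : B ^ q = B ^ (q / 2) * B ^ (q / 2) := by rw [hB.rpow_mul_rpow]; ring_nf
  have hp : A ^ p = A ^ (p / 2) * A ^ (p / 2) := by rw [hA.rpow_mul_rpow]; ring_nf
  rw [hq, hp]
  simp only [mul_assoc]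

/-! ### Smallest eigenvalue and operator norm through the Loewner order. -/

theorem le_minEigenvalue_iff (hn : 0 < n) {M : Matrix (Fin n) (Fin n) ℂ} (hM : M.IsHermitian)
    (c : ℝ) : c ≤ minEigenvalue M ↔ c • (1 : Matrix (Fin n) (Fin n) ℂ) ≤ M := by
  have : Nonempty (Fin n) := ⟨⟨0, hn⟩⟩
  rw [← Algebra.algebraMap_eq_smul_one, algebraMap_le_iff_le_spectrum (ha := hM.isSelfAdjoint),
    minEigenvalue]
  have hne : (spectrum ℝ M).Nonempty := by
    rw [hM.spectrum_real_eq_range_eigenvalues]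
    exact Set.range_nonempty _
  exact le_csInf_iff (Set.toFinite _).bddBelow hne

theorem opNorm_le_iff {M : Matrix (Fin n) (Fin n) ℂ} (hM : 0 ≤ M) {c : ℝ} (hc : 0 ≤ c) :
    opNorm M ≤ c ↔ M ≤ c • (1 : Matrix (Fin n) (Fin n) ℂ) := by
  rw [← Algebra.algebraMap_eq_smul_one]
  exact CStarAlgebra.norm_le_iff_le_algebraMap M hc hM

theorem minEigenvalue_pos (hn : 0 < n) {M : Matrix (Fin n) (Fin n) ℂ} (hM : M.PosDef) :
    0 < minEigenvalue M := by
  obtain ⟨i, hi⟩ := (isLeast_minEigenvalue hn hM.isHermitian).1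
  rw [← hi]
  exact hM.eigenvalues_pos i

theorem opNorm_pos (hn : 0 < n) {M : Matrix (Fin n) (Fin n) ℂ} (hM : M.PosDef) :
    0 < opNorm M := by
  have : Nonempty (Fin n) := ⟨⟨0, hn⟩⟩
  exact (norm_pos_iff (a := M)).2 hM.isUnit.ne_zero

theorem spectrum_rpow_real {M : Matrix (Fin n) (Fin n) ℂ} (hM : 0 ≤ M) (s : ℝ) :
    spectrum ℝ (M ^ s) = (fun x : ℝ => x ^ s) '' spectrum ℝ M := by
  rw [CFC.rpow_eq_cfc_real hM]
  exact cfc_map_spectrum (fun x : ℝ => x ^ s) M (hf := (Set.toFinite _).continuousOn _)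

theorem minEigenvalue_rpow (hn : 0 < n) {M : Matrix (Fin n) (Fin n) ℂ} (hM : M.PosDef) {s : ℝ}
    (hs : 0 < s) : minEigenvalue (M ^ s) = minEigenvalue M ^ s := by
  have hl : IsLeast (spectrum ℝ M) (minEigenvalue M) := by
    have := isLeast_minEigenvalue hn hM.isHermitian
    rwa [← hM.isHermitian.spectrum_real_eq_range_eigenvalues] at this
  have : IsLeast (spectrum ℝ (M ^ s)) (minEigenvalue M ^ s) := by
    rw [spectrum_rpow_real hM.zero_le]
    refine ⟨⟨_, hl.1, rfl⟩, ?_⟩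
    rintro _ ⟨x, hx, rfl⟩
    exact Real.rpow_le_rpow (minEigenvalue_pos hn hM).le (hl.2 hx) hs.le
  exact this.csInf_eq

theorem opNorm_rpow {M : Matrix (Fin n) (Fin n) ℂ} (hM : M.PosDef) {s : ℝ}
    (hs : 0 < s) : opNorm (M ^ s) = opNorm M ^ s :=
  CFC.norm_rpow M hs hM.zero_le

theorem opNorm_eq_of_spectrum_eq {M N : Matrix (Fin n) (Fin n) ℂ} (hM : 0 ≤ M) (hN : 0 ≤ N)
    (h : spectrum ℝ M = spectrum ℝ N) : opNorm M = opNorm N := by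
  have key (c : ℝ) (hc : 0 ≤ c) : opNorm M ≤ c ↔ opNorm N ≤ c := by
    rw [opNorm_le_iff hM hc, opNorm_le_iff hN hc, ← Algebra.algebraMap_eq_smul_one,
      le_algebraMap_iff_spectrum_le (ha := IsSelfAdjoint.of_nonneg hM),
      le_algebraMap_iff_spectrum_le (ha := IsSelfAdjoint.of_nonneg hN), h]
  exact le_antisymm ((key _ (norm_nonneg _)).2 le_rfl) ((key _ (norm_nonneg _)).1 le_rfl)

/-! ### Operator convexity and concavity of powers. -/

theorem Matrix.PosDef.real_smul {A : Matrix (Fin n) (Fin n) ℂ} (hA : A.PosDef) {t : ℝ}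
    (ht : 0 < t) : (t • A).PosDef := hA.smul ht

theorem Matrix.PosDef.convexComb {A B : Matrix (Fin n) (Fin n) ℂ} (hA : A.PosDef) (hB : B.PosDef)
    {a b : ℝ} (ha : 0 ≤ a) (hb : 0 ≤ b) (hab : a + b = 1) : (a • A + b • B).PosDef := by
  rcases ha.eq_or_lt with rfl | ha
  · rw [zero_add] at hab
    simpa [hab] using hB
  · exact (hA.real_smul ha).add_posSemidef (hB.posSemidef.smul hb)

theorem Matrix.PosDef.inv_le_inv {A B : Matrix (Fin n) (Fin n) ℂ} (hA : A.PosDef)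
    (hB : B.PosDef) (h : A ≤ B) : B⁻¹ ≤ A⁻¹ := by
  have := CStarAlgebra.rpow_neg_one_le_rpow_neg_one h (Matrix.isStrictlyPositive_iff_posDef.2 hA)
  rwa [hA.rpow_neg_one, hB.rpow_neg_one] at this

/-- `(X, Y) ↦ Xᴴ Y⁻¹ X` is jointly convex. -/
theorem conjTranspose_mul_inv_mul_convex {Y₁ Y₂ : Matrix (Fin n) (Fin n) ℂ}
    (h₁ : Y₁.PosDef) (h₂ : Y₂.PosDef) (X₁ X₂ : Matrix (Fin n) (Fin n) ℂ) {a b : ℝ} (ha : 0 ≤ a)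
    (hb : 0 ≤ b) (hab : a + b = 1) :
    (a • X₁ + b • X₂).conjTranspose * (a • Y₁ + b • Y₂)⁻¹ * (a • X₁ + b • X₂) ≤
      a • (X₁.conjTranspose * Y₁⁻¹ * X₁) + b • (X₂.conjTranspose * Y₂⁻¹ * X₂) := by
  -- The Schur complement of `Y` in this block matrix is zero, so it is positive semidefinite. Its
  -- off-diagonal and upper left blocks are linear in `(X, Y)`, so the Schur complement of a convex
  -- combination of two such matrices is the required difference.
  have hblock (X Y : Matrix (Fin n) (Fin n) ℂ) (hY : Y.PosDef) :
      (Matrix.fromBlocks Y X X.conjTranspose (X.conjTranspose * Y⁻¹ * X)).PosSemidef := by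
    have := hY.isUnit.invertible
    rw [Matrix.PosDef.fromBlocks₁₁ _ _ hY, sub_self]
    exact Matrix.PosSemidef.zero
  have hY := h₁.convexComb h₂ ha hb hab
  have := hY.isUnit.invertible
  rw [Matrix.le_iff, ← Matrix.PosDef.fromBlocks₁₁ _ _ hY]
  have hs := ((hblock X₁ Y₁ h₁).smul ha).add ((hblock X₂ Y₂ h₂).smul hb)
  simpa [Matrix.fromBlocks_smul, Matrix.fromBlocks_add, Matrix.conjTranspose_add,
    Matrix.conjTranspose_smul] using hs

theorem rpow_concave {r : ℝ} (hr : r ∈ Set.Icc (0 : ℝ) 1) {A B : Matrix (Fin n) (Fin n) ℂ}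
    (hA : A.PosDef) (hB : B.PosDef) {a b : ℝ} (ha : 0 ≤ a) (hb : 0 ≤ b) (hab : a + b = 1) :
    a • A ^ r + b • B ^ r ≤ (a • A + b • B) ^ r :=
  (CFC.concaveOn_rpow hr).2 hA.zero_le hB.zero_le ha hb hab

/-- Write `M ^ r` as `φ(M)ᴴ (M ^ t)⁻¹ φ(M)` with `φ` compatible with convex combinations and `0 ≤ t
≤ 1`: `φ = 1`, `t = -r` on `[-1, 0]`, and `φ = id`, `t = 2 - r` on `[1, 2]`. Concavity of `M ^ t`,
antitonicity of the inverse and joint convexity of `Xᴴ Y⁻¹ X` then combine. -/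
theorem rpow_convex {r : ℝ} (hr : r ∈ Set.Icc (-1 : ℝ) 0 ∪ Set.Icc 1 2)
    {A B : Matrix (Fin n) (Fin n) ℂ} (hA : A.PosDef) (hB : B.PosDef) {a b : ℝ} (ha : 0 ≤ a)
    (hb : 0 ≤ b) (hab : a + b = 1) : (a • A + b • B) ^ r ≤ a • A ^ r + b • B ^ r := by
  have hAB := hA.convexComb hB ha hb hab
  suffices h : ∃ t : ℝ, t ∈ Set.Icc (0 : ℝ) 1 ∧ ∃ φ : Matrix (Fin n) (Fin n) ℂ →
      Matrix (Fin n) (Fin n) ℂ, φ (a • A + b • B) = a • φ A + b • φ B ∧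
      ∀ M, M.PosDef → (φ M).conjTranspose * (M ^ t)⁻¹ * φ M = M ^ r by
    obtain ⟨t, ht, φ, hφ, h⟩ := h
    rw [← h A hA, ← h B hB, ← h _ hAB]
    refine le_trans ?_ (conjTranspose_mul_inv_mul_convex (hA.rpow t) (hB.rpow t) _ _ ha hb hab)
    rw [← hφ]
    exact star_left_conjugate_le_conjugate (((hA.rpow t).convexComb (hB.rpow t) ha hb hab).inv_le_inv
      (hAB.rpow t) (rpow_concave ht hA hB ha hb hab)) _
  rcases hr with hr | hr
  · refine ⟨-r, ⟨by linarith [hr.2], by linarith [hr.1]⟩, fun _ => 1, ?_, fun M hM => ?_⟩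
    · rw [← add_smul, hab, one_smul]
    · simp [hM.inv_rpow]
  · refine ⟨2 - r, ⟨by linarith [hr.2], by linarith [hr.1]⟩, id, rfl, fun M hM => ?_⟩
    have h1 := CFC.rpow_one M hM.zero_le
    rw [id, hM.isHermitian.eq, hM.inv_rpow]
    conv_lhs => rw [← h1, hM.rpow_rpow _ _ one_ne_zero, hM.rpow_mul_rpow, hM.rpow_mul_rpow]
    ring_nf

theorem convex_posDefPairs : Convex ℝ (posDefPairs n) := fun _ hX _ hY _ _ ha hb hab =>
  ⟨hX.1.convexComb hY.1 ha hb hab, hX.2.convexComb hY.2 ha hb hab⟩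

/-! ### Homogeneous functions on cones, and the sufficiency of the conditions. -/

section Homogeneous

variable {E : Type*} [AddCommGroup E] [Module ℝ E] {K : Set E} {h : E → ℝ}

/-- With `α`, `β` the values of a degree-one function at `X`, `Y`, this is a multiple of a convex
combination of two points normalised to level one. -/
theorem eq_smul_convexComb (X Y : E) {a b α β : ℝ} (hα : 0 < α) (hβ : 0 < β)
    (hγ : 0 < a * α + b * β) : a • X + b • Y = (a * α + b * β) •
      ((a * α / (a * α + b * β)) • α⁻¹ • X + (b * β / (a * α + b * β)) • β⁻¹ • Y) := by
  simp only [smul_add, smul_smul]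
  congr 2 <;> field_simp

theorem convexComb_pos {a b α β : ℝ} (ha : 0 ≤ a) (hb : 0 ≤ b) (hab : a + b = 1) (hα : 0 < α)
    (hβ : 0 < β) : 0 < a * α + b * β := by
  rcases ha.eq_or_lt with rfl | ha
  · rw [zero_add] at hab
    simpa [hab] using hβ
  · positivity

/-- A positive function that is homogeneous of degree one on a convex cone is concave as soon as
the superlevel set of level one is convex. -/
theorem concaveOn_of_homogeneous (hK : Convex ℝ K) (hKs : ∀ X ∈ K, ∀ t : ℝ, 0 < t → t • X ∈ K)
    (hpos : ∀ X ∈ K, 0 < h X) (hhom : ∀ X ∈ K, ∀ t : ℝ, 0 < t → h (t • X) = t * h X)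
    (hlevel : ∀ X ∈ K, ∀ Y ∈ K, h X = 1 → h Y = 1 → ∀ a b : ℝ, 0 ≤ a → 0 ≤ b → a + b = 1 →
      1 ≤ h (a • X + b • Y)) : ConcaveOn ℝ K h := by
  refine ⟨hK, fun X hX Y hY a b ha hb hab => ?_⟩
  have hα := hpos X hX
  have hβ := hpos Y hY
  have hγ := convexComb_pos ha hb hab hα hβ
  have hX' := hKs X hX _ (inv_pos.2 hα)
  have hY' := hKs Y hY _ (inv_pos.2 hβ)
  have ha' : 0 ≤ a * h X / (a * h X + b * h Y) := by positivity
  have hb' : 0 ≤ b * h Y / (a * h X + b * h Y) := by positivity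
  have hab' : a * h X / (a * h X + b * h Y) + b * h Y / (a * h X + b * h Y) = 1 := by
    rw [← add_div, div_self hγ.ne']
  rw [eq_smul_convexComb X Y hα hβ hγ, hhom _ (hK hX' hY' ha' hb' hab') _ hγ]
  refine le_mul_of_one_le_right hγ.le (hlevel _ hX' _ hY' ?_ ?_ _ _ ha' hb' hab')
  · rw [hhom X hX _ (inv_pos.2 hα), inv_mul_cancel₀ hα.ne']
  · rw [hhom Y hY _ (inv_pos.2 hβ), inv_mul_cancel₀ hβ.ne']

/-- A positive function that is homogeneous of degree one on a convex cone is convex as soon as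
the sublevel set of level one is convex. -/
theorem convexOn_of_homogeneous (hK : Convex ℝ K) (hKs : ∀ X ∈ K, ∀ t : ℝ, 0 < t → t • X ∈ K)
    (hpos : ∀ X ∈ K, 0 < h X) (hhom : ∀ X ∈ K, ∀ t : ℝ, 0 < t → h (t • X) = t * h X)
    (hlevel : ∀ X ∈ K, ∀ Y ∈ K, h X = 1 → h Y = 1 → ∀ a b : ℝ, 0 ≤ a → 0 ≤ b → a + b = 1 →
      h (a • X + b • Y) ≤ 1) : ConvexOn ℝ K h := by
  refine ⟨hK, fun X hX Y hY a b ha hb hab => ?_⟩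
  have hα := hpos X hX
  have hβ := hpos Y hY
  have hγ := convexComb_pos ha hb hab hα hβ
  have hX' := hKs X hX _ (inv_pos.2 hα)
  have hY' := hKs Y hY _ (inv_pos.2 hβ)
  have ha' : 0 ≤ a * h X / (a * h X + b * h Y) := by positivity
  have hb' : 0 ≤ b * h Y / (a * h X + b * h Y) := by positivity
  have hab' : a * h X / (a * h X + b * h Y) + b * h Y / (a * h X + b * h Y) = 1 := by
    rw [← add_div, div_self hγ.ne']
  rw [eq_smul_convexComb X Y hα hβ hγ, hhom _ (hK hX' hY' ha' hb' hab') _ hγ]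
  refine mul_le_of_le_one_right hγ.le (hlevel _ hX' _ hY' ?_ ?_ _ _ ha' hb' hab')
  · rw [hhom X hX _ (inv_pos.2 hα), inv_mul_cancel₀ hα.ne']
  · rw [hhom Y hY _ (inv_pos.2 hβ), inv_mul_cancel₀ hβ.ne']

end Homogeneous

/-- Since `e < 0`, `e * log` is convex by concavity of `log`, and the increasing convex `exp`
preserves this. -/
theorem rpow_convex_of_neg {e : ℝ} (he : e < 0) {x y a b : ℝ} (hx : 0 < x) (hy : 0 < y)
    (ha : 0 ≤ a) (hb : 0 ≤ b) (hab : a + b = 1) :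
    (a * x + b * y) ^ e ≤ a * x ^ e + b * y ^ e := by
  have hγ := convexComb_pos ha hb hab hx hy
  have h1 := strictConcaveOn_log_Ioi.concaveOn.2 hx hy ha hb hab
  have h2 := convexOn_exp.2 (Set.mem_univ (Real.log x * e)) (Set.mem_univ (Real.log y * e))
    ha hb hab
  simp only [smul_eq_mul] at h1 h2
  rw [Real.rpow_def_of_pos hγ, Real.rpow_def_of_pos hx, Real.rpow_def_of_pos hy]
  refine le_trans (Real.exp_le_exp.2 ?_) h2
  nlinarith

theorem sandwich_smul (p q : ℝ) {A B : Matrix (Fin n) (Fin n) ℂ} (hA : A.PosDef) (hB : B.PosDef)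
    {t : ℝ} (ht : 0 < t) : sandwich p q (t • A) (t • B) = t ^ (p + q) • sandwich p q A B := by
  rw [sandwich, hA.smul_rpow ht, hB.smul_rpow ht, sandwich]
  simp only [smul_mul_assoc, mul_smul_comm, smul_smul]
  rw [← Real.rpow_add ht, ← Real.rpow_add ht]
  ring_nf

theorem minEigenvalue_smul (hn : 0 < n) {M : Matrix (Fin n) (Fin n) ℂ} (hM : M.PosDef) {t : ℝ}
    (ht : 0 < t) : minEigenvalue (t • M) = t * minEigenvalue M := by
  have key (c : ℝ) : c ≤ minEigenvalue (t • M) ↔ c ≤ t * minEigenvalue M := by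
    rw [le_minEigenvalue_iff hn (hM.real_smul ht).isHermitian, ← div_le_iff₀' ht,
      le_minEigenvalue_iff hn hM.isHermitian, ← smul_le_smul_iff_of_pos_left (b₁ := (c / t) • _) ht,
      smul_smul, mul_div_cancel₀ _ ht.ne']
  exact le_antisymm ((key _).1 le_rfl) ((key _).2 le_rfl)

theorem opNorm_smul (M : Matrix (Fin n) (Fin n) ℂ) {t : ℝ} (ht : 0 < t) :
    opNorm (t • M) = t * opNorm M := by
  have : ‖t • M‖ = ‖t‖ * ‖M‖ := norm_smul t M
  rwa [Real.norm_of_nonneg ht.le] at this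

theorem smul_mem_posDefPairs : ∀ X ∈ posDefPairs n, ∀ t : ℝ, 0 < t → t • X ∈ posDefPairs n :=
  fun _ hX _ ht => ⟨hX.1.real_smul ht, hX.2.real_smul ht⟩

/-- If `φ` is positive and homogeneous of degree `r ≠ 0`, then `φ ^ r⁻¹` is positive and
homogeneous of degree one. -/
theorem homogeneous_rpow_inv {φ : Matrix (Fin n) (Fin n) ℂ × Matrix (Fin n) (Fin n) ℂ → ℝ} {r : ℝ}
    (hr : r ≠ 0) (hpos : ∀ X ∈ posDefPairs n, 0 < φ X)
    (hhom : ∀ X ∈ posDefPairs n, ∀ t : ℝ, 0 < t → φ (t • X) = t ^ r * φ X) :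
    ∀ X ∈ posDefPairs n, ∀ t : ℝ, 0 < t → φ (t • X) ^ r⁻¹ = t * φ X ^ r⁻¹ := by
  intro X hX t ht
  rw [hhom X hX t ht, Real.mul_rpow (by positivity) (hpos X hX).le, Real.rpow_rpow_inv ht.le hr]

theorem eq_one_of_rpow_inv_eq_one {x r : ℝ} (hr : r ≠ 0) (hx : 0 < x) (h : x ^ r⁻¹ = 1) :
    x = 1 := by
  rw [← Real.rpow_inv_rpow hx.le hr, h, Real.one_rpow]

theorem minEigenvalue_sandwich_concave (hn : 0 < n) {p q : ℝ} (hp : p ∈ Set.Ioc (0 : ℝ) 1)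
    (hq : q ∈ Set.Ioc (0 : ℝ) 1) :
    ConcaveOn ℝ (posDefPairs n) (fun X => minEigenvalue (sandwich p q X.1 X.2) ^ (p + q)⁻¹) := by
  have hr : 0 < p + q := add_pos hp.1 hq.1
  have hpos : ∀ X ∈ posDefPairs n, 0 < minEigenvalue (sandwich p q X.1 X.2) := fun X hX =>
    minEigenvalue_pos hn (sandwich_posDef p q hX.1 hX.2)
  refine concaveOn_of_homogeneous convex_posDefPairs smul_mem_posDefPairs
    (fun X hX => Real.rpow_pos_of_pos (hpos X hX) _) (homogeneous_rpow_inv hr.ne' hpos ?_) ?_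
  · intro X hX t ht
    change minEigenvalue (sandwich p q (t • X.1) (t • X.2)) = _
    rw [sandwich_smul p q hX.1 hX.2 ht, minEigenvalue_smul hn (sandwich_posDef p q hX.1 hX.2)
      (by positivity)]
  · have level : ∀ X ∈ posDefPairs n,
        (1 ≤ minEigenvalue (sandwich p q X.1 X.2) ↔ X.1 ^ (-p) ≤ X.2 ^ q) := fun X hX => by
      rw [le_minEigenvalue_iff hn (sandwich_posDef p q hX.1 hX.2).isHermitian,
        smul_one_le_sandwich_iff p q 1 hX.1, one_smul]
    intro X hX Y hY hX1 hY1 a b ha hb hab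
    have hX2 := (level X hX).1 (eq_one_of_rpow_inv_eq_one hr.ne' (hpos X hX) hX1).ge
    have hY2 := (level Y hY).1 (eq_one_of_rpow_inv_eq_one hr.ne' (hpos Y hY) hY1).ge
    refine Real.one_le_rpow ((level _ (convex_posDefPairs hX hY ha hb hab)).2 ?_)
      (inv_nonneg.2 hr.le)
    calc (a • X.1 + b • Y.1) ^ (-p) ≤ a • X.1 ^ (-p) + b • Y.1 ^ (-p) :=
          rpow_convex (Or.inl ⟨by linarith [hp.2], by linarith [hp.1]⟩) hX.1 hY.1 ha hb hab
      _ ≤ a • X.2 ^ q + b • Y.2 ^ q :=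
          add_le_add (smul_le_smul_of_nonneg_left hX2 ha) (smul_le_smul_of_nonneg_left hY2 hb)
      _ ≤ (a • X.2 + b • Y.2) ^ q := rpow_concave ⟨hq.1.le, hq.2⟩ hX.2 hY.2 ha hb hab

theorem opNorm_sandwich_le_one_of_convexComb {p q : ℝ} (hp : p ∈ Set.Icc (-1 : ℝ) 0)
    (hq : q ∈ Set.Icc (-1 : ℝ) 0 ∪ Set.Icc 1 2) :
    ∀ X ∈ posDefPairs n, ∀ Y ∈ posDefPairs n, opNorm (sandwich p q X.1 X.2) = 1 →
      opNorm (sandwich p q Y.1 Y.2) = 1 → ∀ a b : ℝ, 0 ≤ a → 0 ≤ b → a + b = 1 →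
      opNorm (sandwich p q (a • X + b • Y).1 (a • X + b • Y).2) ≤ 1 := by
  have level : ∀ X ∈ posDefPairs n,
      (opNorm (sandwich p q X.1 X.2) ≤ 1 ↔ X.2 ^ q ≤ X.1 ^ (-p)) := fun X hX => by
    rw [opNorm_le_iff (sandwich_posDef p q hX.1 hX.2).zero_le zero_le_one,
      sandwich_le_smul_one_iff p q 1 hX.1, one_smul]
  intro X hX Y hY hX1 hY1 a b ha hb hab
  have hX2 := (level X hX).1 hX1.le
  have hY2 := (level Y hY).1 hY1.le
  refine (level _ (convex_posDefPairs hX hY ha hb hab)).2 ?_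
  calc (a • X.2 + b • Y.2) ^ q ≤ a • X.2 ^ q + b • Y.2 ^ q :=
        rpow_convex hq hX.2 hY.2 ha hb hab
    _ ≤ a • X.1 ^ (-p) + b • Y.1 ^ (-p) :=
        add_le_add (smul_le_smul_of_nonneg_left hX2 ha) (smul_le_smul_of_nonneg_left hY2 hb)
    _ ≤ (a • X.1 + b • Y.1) ^ (-p) :=
        rpow_concave ⟨by linarith [hp.2], by linarith [hp.1]⟩ hX.1 hY.1 ha hb hab

theorem opNorm_sandwich_pos (hn : 0 < n) (p q : ℝ) :
    ∀ X ∈ posDefPairs n, 0 < opNorm (sandwich p q X.1 X.2) := fun _ hX =>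
  opNorm_pos hn (sandwich_posDef p q hX.1 hX.2)

theorem opNorm_sandwich_smul (p q : ℝ) : ∀ X ∈ posDefPairs n, ∀ t : ℝ, 0 < t →
    opNorm (sandwich p q (t • X).1 (t • X).2) = t ^ (p + q) * opNorm (sandwich p q X.1 X.2) := by
  intro X hX t ht
  change opNorm (sandwich p q (t • X.1) (t • X.2)) = _
  rw [sandwich_smul p q hX.1 hX.2 ht, opNorm_smul _ (by positivity)]

theorem opNorm_sandwich_convex (hn : 0 < n) {p q : ℝ} (hp : p ∈ Set.Icc (-1 : ℝ) 0)
    (hq : q ∈ Set.Icc (1 : ℝ) 2) (hr : 0 < p + q) :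
    ConvexOn ℝ (posDefPairs n) (fun X => opNorm (sandwich p q X.1 X.2) ^ (p + q)⁻¹) := by
  have hpos := opNorm_sandwich_pos hn p q
  refine convexOn_of_homogeneous convex_posDefPairs smul_mem_posDefPairs
    (fun X hX => Real.rpow_pos_of_pos (hpos X hX) _)
    (homogeneous_rpow_inv hr.ne' hpos (opNorm_sandwich_smul p q)) ?_
  intro X hX Y hY hX1 hY1 a b ha hb hab
  exact Real.rpow_le_one (hpos _ (convex_posDefPairs hX hY ha hb hab)).le
    (opNorm_sandwich_le_one_of_convexComb hp (Or.inr hq) X hX Y hY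
      (eq_one_of_rpow_inv_eq_one hr.ne' (hpos X hX) hX1)
      (eq_one_of_rpow_inv_eq_one hr.ne' (hpos Y hY) hY1) a b ha hb hab) (inv_nonneg.2 hr.le)

/-- Here `(p + q)⁻¹` is negative, so the sublevel condition for the norm becomes a superlevel
condition for its power; hence concavity rather than convexity. -/
theorem opNorm_sandwich_concave (hn : 0 < n) {p q : ℝ} (hp : p ∈ Set.Icc (-1 : ℝ) 0)
    (hq : q ∈ Set.Icc (-1 : ℝ) 0) (hr : p + q < 0) :
    ConcaveOn ℝ (posDefPairs n) (fun X => opNorm (sandwich p q X.1 X.2) ^ (p + q)⁻¹) := by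
  have hpos := opNorm_sandwich_pos hn p q
  refine concaveOn_of_homogeneous convex_posDefPairs smul_mem_posDefPairs
    (fun X hX => Real.rpow_pos_of_pos (hpos X hX) _)
    (homogeneous_rpow_inv hr.ne hpos (opNorm_sandwich_smul p q)) ?_
  intro X hX Y hY hX1 hY1 a b ha hb hab
  exact Real.one_le_rpow_of_pos_of_le_one_of_nonpos (hpos _ (convex_posDefPairs hX hY ha hb hab))
    (opNorm_sandwich_le_one_of_convexComb hp (Or.inl hq) X hX Y hY
      (eq_one_of_rpow_inv_eq_one hr.ne (hpos X hX) hX1)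
      (eq_one_of_rpow_inv_eq_one hr.ne (hpos Y hY) hY1) a b ha hb hab) (inv_nonpos.2 hr.le)

theorem minEigenvalue_sandwichPower (hn : 0 < n) (p q : ℝ) {s : ℝ} (hs : 0 < s) :
    ∀ X ∈ posDefPairs n, minEigenvalue (sandwichPower p q s X.1 X.2) =
      minEigenvalue (sandwich p q X.1 X.2) ^ s := fun _ hX =>
  minEigenvalue_rpow hn (sandwich_posDef p q hX.1 hX.2) hs

theorem opNorm_sandwichPower (p q : ℝ) {s : ℝ} (hs : 0 < s) :
    ∀ X ∈ posDefPairs n, opNorm (sandwichPower p q s X.1 X.2) =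
      opNorm (sandwich p q X.1 X.2) ^ s := fun _ hX =>
  opNorm_rpow (sandwich_posDef p q hX.1 hX.2) hs

theorem rpow_inv_rpow_mul {x : ℝ} (hx : 0 < x) {r : ℝ} (hr : r ≠ 0) (s : ℝ) :
    x ^ s = (x ^ r⁻¹) ^ (r * s) := by
  rw [← Real.rpow_mul hx.le, inv_mul_cancel_left₀ hr]

theorem jointlyConcave_of_pos (hn : 0 < n) {p q s : ℝ} (hp : p ∈ Set.Ioc (0 : ℝ) 1)
    (hq : q ∈ Set.Ioc (0 : ℝ) 1) (hs : 0 < s) (hs' : s ≤ 1 / (p + q)) :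
    JointlyConcaveMinEigenvalue n p q s := by
  have hr : 0 < p + q := add_pos hp.1 hq.1
  have hpos : ∀ X ∈ posDefPairs n, 0 < minEigenvalue (sandwich p q X.1 X.2) := fun X hX =>
    minEigenvalue_pos hn (sandwich_posDef p q hX.1 hX.2)
  have hc := minEigenvalue_sandwich_concave (n := n) hn hp hq
  have hrs : (p + q) * s ≤ 1 := by rwa [le_div_iff₀' hr] at hs'
  refine ⟨convex_posDefPairs, fun X hX Y hY a b ha hb hab => ?_⟩
  have hZ := convex_posDefPairs hX hY ha hb hab
  have h1 := hc.2 hX hY ha hb hab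
  simp only [smul_eq_mul] at h1 ⊢
  rw [minEigenvalue_sandwichPower hn p q hs X hX, minEigenvalue_sandwichPower hn p q hs Y hY,
    minEigenvalue_sandwichPower hn p q hs _ hZ, rpow_inv_rpow_mul (hpos X hX) hr.ne',
    rpow_inv_rpow_mul (hpos Y hY) hr.ne', rpow_inv_rpow_mul (hpos _ hZ) hr.ne']
  have hx := Real.rpow_pos_of_pos (hpos X hX) (p + q)⁻¹
  have hy := Real.rpow_pos_of_pos (hpos Y hY) (p + q)⁻¹
  refine le_trans ((Real.concaveOn_rpow (by positivity) hrs).2 hx.le hy.le ha hb hab) ?_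
  exact Real.rpow_le_rpow (convexComb_pos ha hb hab hx hy).le h1 (by positivity)

theorem jointlyConvex_of_mixed (hn : 0 < n) {p q s : ℝ} (hp : p ∈ Set.Icc (-1 : ℝ) 0)
    (hq : q ∈ Set.Icc (1 : ℝ) 2) (hr : 0 < p + q) (hs : 1 / (p + q) ≤ s) :
    JointlyConvexOpNorm n p q s := by
  have hs0 : 0 < s := lt_of_lt_of_le (by positivity) hs
  have hpos := opNorm_sandwich_pos hn p q
  have hc := opNorm_sandwich_convex (n := n) hn hp hq hr
  have hrs : 1 ≤ (p + q) * s := by rwa [div_le_iff₀' hr] at hs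
  refine ⟨convex_posDefPairs, fun X hX Y hY a b ha hb hab => ?_⟩
  have hZ := convex_posDefPairs hX hY ha hb hab
  have h1 := hc.2 hX hY ha hb hab
  simp only [smul_eq_mul] at h1 ⊢
  rw [opNorm_sandwichPower p q hs0 X hX, opNorm_sandwichPower p q hs0 Y hY,
    opNorm_sandwichPower p q hs0 _ hZ, rpow_inv_rpow_mul (hpos X hX) hr.ne',
    rpow_inv_rpow_mul (hpos Y hY) hr.ne', rpow_inv_rpow_mul (hpos _ hZ) hr.ne']
  have hx := Real.rpow_pos_of_pos (hpos X hX) (p + q)⁻¹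
  have hy := Real.rpow_pos_of_pos (hpos Y hY) (p + q)⁻¹
  refine le_trans ?_ ((convexOn_rpow hrs).2 hx.le hy.le ha hb hab)
  exact Real.rpow_le_rpow (Real.rpow_pos_of_pos (hpos _ hZ) _).le h1 (by positivity)

theorem jointlyConvex_of_neg (hn : 0 < n) {p q s : ℝ} (hp : p ∈ Set.Icc (-1 : ℝ) 0)
    (hq : q ∈ Set.Icc (-1 : ℝ) 0) (hr : p + q < 0) (hs : 0 < s) :
    JointlyConvexOpNorm n p q s := by
  have hpos := opNorm_sandwich_pos hn p q
  have hc := opNorm_sandwich_concave (n := n) hn hp hq hr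
  have hrs : (p + q) * s < 0 := mul_neg_of_neg_of_pos hr hs
  refine ⟨convex_posDefPairs, fun X hX Y hY a b ha hb hab => ?_⟩
  have hZ := convex_posDefPairs hX hY ha hb hab
  have h1 := hc.2 hX hY ha hb hab
  simp only [smul_eq_mul] at h1 ⊢
  rw [opNorm_sandwichPower p q hs X hX, opNorm_sandwichPower p q hs Y hY,
    opNorm_sandwichPower p q hs _ hZ, rpow_inv_rpow_mul (hpos X hX) hr.ne,
    rpow_inv_rpow_mul (hpos Y hY) hr.ne, rpow_inv_rpow_mul (hpos _ hZ) hr.ne]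
  have hx := Real.rpow_pos_of_pos (hpos X hX) (p + q)⁻¹
  have hy := Real.rpow_pos_of_pos (hpos Y hY) (p + q)⁻¹
  refine le_trans ?_ (rpow_convex_of_neg hrs hx hy ha hb hab)
  exact Real.rpow_le_rpow_of_nonpos (convexComb_pos ha hb hab hx hy) h1 hrs.le

/-! ### Symmetries: inversion and exchange of the variables. -/

theorem jointlyConcave_neg_iff (p q s : ℝ) :
    JointlyConcaveMinEigenvalue n (-p) (-q) (-s) ↔ JointlyConcaveMinEigenvalue n p q s :=
  have h : Set.EqOn (fun X => minEigenvalue (sandwichPower (-p) (-q) (-s) X.1 X.2))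
      (fun X => minEigenvalue (sandwichPower p q s X.1 X.2)) (posDefPairs n) := fun X hX => by
    simp only [sandwichPower_neg p q s hX.1 hX.2]
  ⟨fun hc => hc.congr h, fun hc => hc.congr h.symm⟩

theorem jointlyConvex_neg_iff (p q s : ℝ) :
    JointlyConvexOpNorm n (-p) (-q) (-s) ↔ JointlyConvexOpNorm n p q s :=
  have h : Set.EqOn (fun X => opNorm (sandwichPower (-p) (-q) (-s) X.1 X.2))
      (fun X => opNorm (sandwichPower p q s X.1 X.2)) (posDefPairs n) := fun X hX => by
    simp only [sandwichPower_neg p q s hX.1 hX.2]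
  ⟨fun hc => hc.congr h, fun hc => hc.congr h.symm⟩

theorem spectrum_sandwichPower_comm (p q s : ℝ) {A B : Matrix (Fin n) (Fin n) ℂ} (hA : A.PosDef)
    (hB : B.PosDef) : spectrum ℝ (sandwichPower q p s B A) = spectrum ℝ (sandwichPower p q s A B) := by
  change spectrum ℝ (sandwich q p B A ^ s) = spectrum ℝ (sandwich p q A B ^ s)
  rw [spectrum_rpow_real (sandwich_posDef q p hB hA).zero_le,
    spectrum_rpow_real (sandwich_posDef p q hA hB).zero_le, spectrum_sandwich_comm p q hA hB]

theorem JointlyConcaveMinEigenvalue.swap {p q s : ℝ} (h : JointlyConcaveMinEigenvalue n p q s) :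
    JointlyConcaveMinEigenvalue n q p s := by
  refine ⟨convex_posDefPairs, fun X hX Y hY a b ha hb hab => ?_⟩
  have key : ∀ Z ∈ posDefPairs n, minEigenvalue (sandwichPower q p s Z.1 Z.2) =
      minEigenvalue (sandwichPower p q s Z.2 Z.1) := fun Z hZ => by
    rw [minEigenvalue, minEigenvalue, spectrum_sandwichPower_comm p q s hZ.2 hZ.1]
  have := h.2 (x := X.swap) (y := Y.swap) ⟨hX.2, hX.1⟩ ⟨hY.2, hY.1⟩ ha hb hab
  beta_reduce
  rw [key X hX, key Y hY, key _ (convex_posDefPairs hX hY ha hb hab)]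
  exact this

theorem JointlyConvexOpNorm.swap {p q s : ℝ} (h : JointlyConvexOpNorm n p q s) :
    JointlyConvexOpNorm n q p s := by
  refine ⟨convex_posDefPairs, fun X hX Y hY a b ha hb hab => ?_⟩
  have key : ∀ Z ∈ posDefPairs n, opNorm (sandwichPower q p s Z.1 Z.2) =
      opNorm (sandwichPower p q s Z.2 Z.1) := fun Z hZ =>
    opNorm_eq_of_spectrum_eq ((sandwich_posDef q p hZ.1 hZ.2).rpow s).zero_le
      ((sandwich_posDef p q hZ.2 hZ.1).rpow s).zero_le (spectrum_sandwichPower_comm p q s hZ.2 hZ.1)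
  have := h.2 (x := X.swap) (y := Y.swap) ⟨hX.2, hX.1⟩ ⟨hY.2, hY.1⟩ ha hb hab
  beta_reduce
  rw [key X hX, key Y hY, key _ (convex_posDefPairs hX hY ha hb hab)]
  exact this

/-! ### Explicit two-by-two matrices and the exponent bound for monotone powers. -/

open Filter Topology in
-- Used to pass from positive definite test matrices to singular ones, where the inequalities become
-- explicit.
theorem nonneg_of_forall_small {f : ℝ → ℝ} (hf : ContinuousAt f 0)
    (h : ∀ t, 0 < t → t < 1 → 0 ≤ f t) : 0 ≤ f 0 := by
  have h1 : Tendsto f (𝓝[>] 0) (𝓝 (f 0)) := hf.tendsto.mono_left nhdsWithin_le_nhds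
  refine ge_of_tendsto h1 ?_
  filter_upwards [Ioo_mem_nhdsGT (zero_lt_one' ℝ)] with t ht using h t ht.1 ht.2

section Projection

variable {P : Matrix (Fin n) (Fin n) ℂ}

theorem projComb_mul (hP : P * P = P) (a b c d : ℝ) :
    (a • P + b • (1 - P)) * (c • P + d • (1 - P)) = (a * c) • P + (b * d) • (1 - P) := by
  have h1 : P * (1 - P) = 0 := by rw [mul_sub, hP, mul_one, sub_self]
  have h2 : (1 - P) * P = 0 := by rw [sub_mul, hP, one_mul, sub_self]
  have h3 : (1 - P) * (1 - P) = 1 - P := by rw [mul_sub, h2, mul_one, sub_zero]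
  simp only [add_mul, mul_add, smul_mul_assoc, mul_smul_comm, smul_smul, hP, h1, h2, h3, smul_zero,
    add_zero, zero_add, mul_comm a, mul_comm b]

theorem projComb_posDef (hP : P * P = P) (hH : P.IsHermitian) {x y : ℝ} (hx : 0 < x)
    (hy : 0 < y) : (x • P + y • (1 - P)).PosDef := by
  have hH' : (√x • P + √y • (1 - P)).IsHermitian := by
    simp [Matrix.IsHermitian, hH.eq]
  have h := projComb_mul hP √x √y √x √y
  rw [Real.mul_self_sqrt hx.le, Real.mul_self_sqrt hy.le] at h
  have hinv : (x • P + y • (1 - P)) * (x⁻¹ • P + y⁻¹ • (1 - P)) = 1 := by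
    rw [projComb_mul hP, mul_inv_cancel₀ hx.ne', mul_inv_cancel₀ hy.ne', one_smul, one_smul,
      add_sub_cancel]
  refine (Matrix.PosSemidef.posDef_iff_isUnit ?_).2 (IsUnit.of_mul_eq_one _ hinv)
  rw [← h]
  nth_rw 1 [← hH'.eq]
  exact Matrix.posSemidef_conjTranspose_mul_self _

theorem projComb_rpow (hP : P * P = P) (hH : P.IsHermitian) {x y : ℝ} (hx : 0 < x)
    (hy : 0 < y) (r : ℝ) :
    (x • P + y • (1 - P)) ^ r = x ^ r • P + y ^ r • (1 - P) := by
  set M := x • P + y • (1 - P) with hM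
  have hMp := projComb_posDef hP hH hx hy
  rw [← hM] at hMp
  have hspec : ∀ t ∈ spectrum ℝ M, t = x ∨ t = y := by
    intro t ht
    by_contra! hne
    refine ht (spectrum.mem_resolventSet_iff.2 ?_)
    have e : algebraMap ℝ (Matrix (Fin n) (Fin n) ℂ) t - M
        = (t - x) • P + (t - y) • (1 - P) := by
      rw [Algebra.algebraMap_eq_smul_one, hM]
      module
    rw [e]
    refine IsUnit.of_mul_eq_one ((t - x)⁻¹ • P + (t - y)⁻¹ • (1 - P)) ?_
    rw [projComb_mul hP, mul_inv_cancel₀ (sub_ne_zero.2 hne.1),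
      mul_inv_cancel₀ (sub_ne_zero.2 hne.2), one_smul, one_smul, add_sub_cancel]
  -- On a spectrum inside `{x, y}` the power function agrees with an affine function, whose
  -- functional calculus is immediate.
  obtain ⟨α, β, h1, h2⟩ : ∃ α β : ℝ, x ^ r = α + β * x ∧ y ^ r = α + β * y := by
    rcases eq_or_ne x y with rfl | hne
    · exact ⟨x ^ r, 0, by simp, by simp⟩
    · have := sub_ne_zero.2 hne
      refine ⟨x ^ r - (x ^ r - y ^ r) / (x - y) * x, (x ^ r - y ^ r) / (x - y), by ring, ?_⟩
      field_simp
      ring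
  have hcfc : M ^ r = cfc (fun t : ℝ => α + β * t) M := by
    rw [CFC.rpow_eq_cfc_real hMp.zero_le]
    refine cfc_congr fun t ht => ?_
    rcases hspec t ht with rfl | rfl <;> simp [h1, h2]
  rw [hcfc, cfc_const_add α (fun t : ℝ => β * t) M (ha := hMp.isHermitian.isSelfAdjoint),
    cfc_const_mul_id β M (ha := hMp.isHermitian.isSelfAdjoint), h1, h2,
    Algebra.algebraMap_eq_smul_one, hM]
  module

end Projection

/-- The real symmetric matrix with diagonal `c, 1 - c` and off-diagonal entry `d`. It is a
projection if `d ^ 2 = c * (1 - c)`. -/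
noncomputable def symmProj (c d : ℝ) : Matrix (Fin 2) (Fin 2) ℂ :=
  !![(c : ℂ), (d : ℂ); (d : ℂ), ((1 - c : ℝ) : ℂ)]

theorem symmProj_mul_self {c d : ℝ} (h : d ^ 2 = c * (1 - c)) :
    symmProj c d * symmProj c d = symmProj c d := by
  have h' : (d : ℂ) ^ 2 = c * (1 - c) := by exact_mod_cast h
  ext i j
  fin_cases i <;> fin_cases j <;> simp [symmProj] <;>
    first | linear_combination h' | ring

theorem symmProj_isHermitian (c d : ℝ) : (symmProj c d).IsHermitian := by
  ext i j
  fin_cases i <;> fin_cases j <;> simp [symmProj, Matrix.conjTranspose]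

/-- The matrix with eigenvalues `x` and `y` and spectral projection `symmProj c d` for `x`. -/
noncomputable def symmMat (c d x y : ℝ) : Matrix (Fin 2) (Fin 2) ℂ :=
  x • symmProj c d + y • (1 - symmProj c d)

theorem symmMat_posDef {c d x y : ℝ} (h : d ^ 2 = c * (1 - c)) (hx : 0 < x) (hy : 0 < y) :
    (symmMat c d x y).PosDef :=
  projComb_posDef (symmProj_mul_self h) (symmProj_isHermitian c d) hx hy

theorem symmMat_rpow {c d x y : ℝ} (h : d ^ 2 = c * (1 - c)) (hx : 0 < x) (hy : 0 < y) (r : ℝ) :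
    symmMat c d x y ^ r = symmMat c d (x ^ r) (y ^ r) :=
  projComb_rpow (symmProj_mul_self h) (symmProj_isHermitian c d) hx hy r

theorem symmMat_eq (c d x y : ℝ) : symmMat c d x y =
    !![((x * c + y * (1 - c) : ℝ) : ℂ), (((x - y) * d : ℝ) : ℂ);
      (((x - y) * d : ℝ) : ℂ), ((x * (1 - c) + y * c : ℝ) : ℂ)] := by
  ext i j
  fin_cases i <;> fin_cases j <;> simp [symmMat, symmProj] <;> ring

theorem symmMat_diagonal (x y : ℝ) : symmMat 1 0 x y = !![(x : ℂ), 0; 0, (y : ℂ)] := by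
  simp [symmMat_eq]

theorem posDef_of_det_pos {a b c : ℝ} (ha : 0 < a) (h : 0 < a * c - b ^ 2) :
    (!![(a : ℂ), (b : ℂ); (b : ℂ), (c : ℂ)]).PosDef := by
  have h1 : (Matrix.diagonal ![(0 : ℂ), ((c - b ^ 2 / a : ℝ) : ℂ)]).PosSemidef := by
    refine Matrix.PosSemidef.diagonal fun i => ?_
    have : 0 ≤ c - b ^ 2 / a := by
      rw [sub_nonneg, div_le_iff₀ ha]
      linarith
    fin_cases i
    · simp
    · exact Complex.zero_le_real.2 this
  have h2 := (Matrix.posSemidef_vecMulVec_self_star ![(a : ℂ), (b : ℂ)]).smul (inv_pos.2 ha).le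
  have hac : (a : ℂ) ≠ 0 := by exact_mod_cast ha.ne'
  have e : !![(a : ℂ), (b : ℂ); (b : ℂ), (c : ℂ)] =
      a⁻¹ • Matrix.vecMulVec ![(a : ℂ), (b : ℂ)] (star ![(a : ℂ), (b : ℂ)]) +
        Matrix.diagonal ![(0 : ℂ), ((c - b ^ 2 / a : ℝ) : ℂ)] := by
    ext i j
    rw [Matrix.add_apply, Matrix.smul_apply, Matrix.vecMulVec_apply]
    fin_cases i <;> fin_cases j <;> simp <;> field_simp
    ring
  have hps := h2.add h1
  rw [← e] at hps
  refine hps.posDef_iff_det_ne_zero.2 ?_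
  rw [Matrix.det_fin_two_of]
  have : ((a * c - b ^ 2 : ℝ) : ℂ) ≠ 0 := by exact_mod_cast h.ne'
  intro h0
  refine this ?_
  push_cast
  linear_combination h0

/-- Compare `diag(2, 1)` with `(4/3) P`, where `P` projects onto the span of `(1, 1)` and `4/3` is
the largest admissible factor; `t` makes both the matrix and the difference positive definite. In
the limit, the determinant of the difference of the powers is nonnegative only if `(4/3)^q + (2/3)^q
≤ 2`, contrary to strict convexity about the mean `1` when `q > 1`. -/
theorem le_one_of_rpow_monotone {q : ℝ}
    (hmono : ∀ B B' : Matrix (Fin 2) (Fin 2) ℂ, B.PosDef → B'.PosDef → (B' - B).PosDef →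
      B ^ q ≤ B' ^ q) : q ≤ 1 := by
  by_contra! hq
  have hP1 : (1 / 2 : ℝ) ^ 2 = (1 / 2) * (1 - 1 / 2) := by norm_num
  have hP3 : (0 : ℝ) ^ 2 = 1 * (1 - 1) := by norm_num
  have key (t : ℝ) (ht : 0 < t) (ht1 : t < 1 / 2) :
      0 ≤ 2 ^ q - (2 ^ q + 1) * ((4 / 3 - 2 * t) ^ q + t ^ q) / 2 + (4 / 3 - 2 * t) ^ q * t ^ q := by
    have hl : 0 < 4 / 3 - 2 * t := by linarith
    have := hmono (symmMat (1 / 2) (1 / 2) (4 / 3 - 2 * t) t) (symmMat 1 0 2 1)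
      (symmMat_posDef hP1 hl ht) (symmMat_posDef hP3 two_pos one_pos) ?_
    · rw [symmMat_rpow hP1 hl ht, symmMat_rpow hP3 two_pos one_pos, Matrix.le_iff] at this
      have := this.det_nonneg
      rw [Matrix.det_fin_two, symmMat_diagonal, symmMat_eq] at this
      simp only [Matrix.sub_apply, Matrix.of_apply, Matrix.cons_val', Matrix.cons_val_zero,
        Matrix.cons_val_one, Matrix.cons_val_fin_one] at this
      norm_cast at this
      simp only [Real.one_rpow] at this
      nlinarith
    · have e : symmMat 1 0 2 1 - symmMat (1 / 2) (1 / 2) (4 / 3 - 2 * t) t =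
          !![((4 / 3 + t / 2 : ℝ) : ℂ), ((-(2 / 3 - 3 * t / 2) : ℝ) : ℂ);
            ((-(2 / 3 - 3 * t / 2) : ℝ) : ℂ), ((1 / 3 + t / 2 : ℝ) : ℂ)] := by
        rw [symmMat_eq, symmMat_eq]
        ext i j
        fin_cases i <;> fin_cases j <;> simp <;> ring
      rw [e]
      refine posDef_of_det_pos (by linarith) ?_
      nlinarith
  have hlim := nonneg_of_forall_small (f := fun t : ℝ => 2 ^ q -
    (2 ^ q + 1) * ((4 / 3 - 2 * (t / 2)) ^ q + (t / 2) ^ q) / 2 +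
      (4 / 3 - 2 * (t / 2)) ^ q * (t / 2) ^ q) (by
    refine Continuous.continuousAt ?_
    have h1 : Continuous fun t : ℝ => (4 / 3 - 2 * (t / 2)) ^ q :=
      Continuous.rpow_const (by fun_prop) fun _ => Or.inr (by linarith)
    have h2 : Continuous fun t : ℝ => (t / 2) ^ q :=
      Continuous.rpow_const (by fun_prop) fun _ => Or.inr (by linarith)
    fun_prop) fun t ht ht1 => key (t / 2) (by linarith) (by linarith)
  simp only [zero_div, mul_zero, sub_zero, Real.zero_rpow (by linarith : q ≠ 0), add_zero] at hlim
  have hJ := (strictConvexOn_rpow hq).2 (show (4 / 3 : ℝ) ∈ Set.Ici 0 by norm_num)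
    (show (2 / 3 : ℝ) ∈ Set.Ici 0 by norm_num) (by norm_num) one_half_pos one_half_pos
    (by norm_num)
  simp only [smul_eq_mul] at hJ
  norm_num at hJ
  have h2 : (2 : ℝ) ^ q * (2 / 3) ^ q = (4 / 3) ^ q := by
    rw [← Real.mul_rpow (by norm_num) (by norm_num)]
    norm_num
  have h3 : (0 : ℝ) < 2 ^ q := by positivity
  nlinarith

/-! ### Reduction to a diagonal entry, and the bounds `1 ≤ q ≤ 2`. -/

theorem diag_re_le_opNorm {M : Matrix (Fin n) (Fin n) ℂ} (hM : M.PosDef) (i : Fin n) :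
    (M i i).re ≤ opNorm M := by
  have h := (opNorm_le_iff hM.zero_le (norm_nonneg _)).1 (le_refl (opNorm M))
  rw [Matrix.le_iff] at h
  have := (Complex.le_def.1 (h.diag_nonneg (i := i))).1
  simpa [opNorm] using this

theorem opNorm_le_trace {M : Matrix (Fin n) (Fin n) ℂ} (hM : M.PosDef) :
    opNorm M ≤ M.trace.re := by
  have htr : M.trace.re = ∑ i, hM.isHermitian.eigenvalues i := by
    rw [hM.isHermitian.trace_eq_sum_eigenvalues]
    simp
  rw [htr, opNorm_le_iff hM.zero_le (Finset.sum_nonneg fun i _ => (hM.eigenvalues_pos i).le),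
    ← Algebra.algebraMap_eq_smul_one,
    le_algebraMap_iff_spectrum_le (ha := hM.isHermitian.isSelfAdjoint),
    hM.isHermitian.spectrum_real_eq_range_eigenvalues]
  rintro _ ⟨i, rfl⟩
  exact Finset.single_le_sum (fun i _ => (hM.eigenvalues_pos i).le) (Finset.mem_univ i)

theorem JointlyConvexOpNorm.apply {p q s : ℝ} (hs : 0 < s) (h : JointlyConvexOpNorm n p q s)
    {A₁ A₂ B₁ B₂ : Matrix (Fin n) (Fin n) ℂ} (hA₁ : A₁.PosDef) (hA₂ : A₂.PosDef) (hB₁ : B₁.PosDef)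
    (hB₂ : B₂.PosDef) {a b : ℝ} (ha : 0 ≤ a) (hb : 0 ≤ b) (hab : a + b = 1) :
    opNorm (sandwich p q (a • A₁ + b • A₂) (a • B₁ + b • B₂)) ^ s ≤
      a * opNorm (sandwich p q A₁ B₁) ^ s + b * opNorm (sandwich p q A₂ B₂) ^ s := by
  have hX : (A₁, B₁) ∈ posDefPairs n := ⟨hA₁, hB₁⟩
  have hY : (A₂, B₂) ∈ posDefPairs n := ⟨hA₂, hB₂⟩
  have := h.2 hX hY ha hb hab
  beta_reduce at this
  rwa [opNorm_sandwichPower p q hs _ hX, opNorm_sandwichPower p q hs _ hY,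
    opNorm_sandwichPower p q hs _ (convex_posDefPairs hX hY ha hb hab)] at this

theorem JointlyConcaveMinEigenvalue.apply (hn : 0 < n) {p q s : ℝ} (hs : 0 < s)
    (h : JointlyConcaveMinEigenvalue n p q s)
    {A₁ A₂ B₁ B₂ : Matrix (Fin n) (Fin n) ℂ} (hA₁ : A₁.PosDef) (hA₂ : A₂.PosDef) (hB₁ : B₁.PosDef)
    (hB₂ : B₂.PosDef) {a b : ℝ} (ha : 0 ≤ a) (hb : 0 ≤ b) (hab : a + b = 1) :
    a * minEigenvalue (sandwich p q A₁ B₁) ^ s + b * minEigenvalue (sandwich p q A₂ B₂) ^ s ≤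
      minEigenvalue (sandwich p q (a • A₁ + b • A₂) (a • B₁ + b • B₂)) ^ s := by
  have hX : (A₁, B₁) ∈ posDefPairs n := ⟨hA₁, hB₁⟩
  have hY : (A₂, B₂) ∈ posDefPairs n := ⟨hA₂, hB₂⟩
  have := h.2 hX hY ha hb hab
  beta_reduce at this
  rwa [minEigenvalue_sandwichPower hn p q hs _ hX, minEigenvalue_sandwichPower hn p q hs _ hY,
    minEigenvalue_sandwichPower hn p q hs _ (convex_posDefPairs hX hY ha hb hab)] at this

/-- Choose `A` with `A^{p/2} = diag(1, t)`. The norm lies between the first diagonal entry and the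
trace, and these agree as `t → 0`. -/
theorem JointlyConvexOpNorm.entry_convex {p q s : ℝ} (hp : p ≠ 0) (hs : 0 < s)
    (h : JointlyConvexOpNorm 2 p q s) {B₁ B₂ : Matrix (Fin 2) (Fin 2) ℂ} (hB₁ : B₁.PosDef)
    (hB₂ : B₂.PosDef) {a b : ℝ} (ha : 0 ≤ a) (hb : 0 ≤ b) (hab : a + b = 1) :
    (((a • B₁ + b • B₂) ^ q) 0 0).re ^ s ≤
      a * ((B₁ ^ q) 0 0).re ^ s + b * ((B₂ ^ q) 0 0).re ^ s := by
  have hP3 : (0 : ℝ) ^ 2 = 1 * (1 - 1) := by norm_num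
  have hnn (B : Matrix (Fin 2) (Fin 2) ℂ) (hB : B.PosDef) (i : Fin 2) : 0 ≤ ((B ^ q) i i).re :=
    (Complex.le_def.1 ((hB.rpow q).posSemidef.diag_nonneg (i := i))).1
  have key (t : ℝ) (ht : 0 < t) : (((a • B₁ + b • B₂) ^ q) 0 0).re ^ s ≤
      a * (((B₁ ^ q) 0 0).re + t ^ 2 * ((B₁ ^ q) 1 1).re) ^ s +
        b * (((B₂ ^ q) 0 0).re + t ^ 2 * ((B₂ ^ q) 1 1).re) ^ s := by
    have htp : 0 < t ^ (2 / p) := by positivity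
    have hA := symmMat_posDef hP3 one_pos htp
    have hAp : symmMat 1 0 1 (t ^ (2 / p)) ^ (p / 2) = !![1, 0; 0, (t : ℂ)] := by
      rw [symmMat_rpow hP3 one_pos htp, ← Real.rpow_mul ht.le, symmMat_eq]
      have : 2 / p * (p / 2) = 1 := by field_simp
      simp [this]
    have hentry (B : Matrix (Fin 2) (Fin 2) ℂ) (i : Fin 2) :
        (sandwich p q (symmMat 1 0 1 (t ^ (2 / p))) B) i i =
          ![(1 : ℂ), (t : ℂ) ^ 2] i * (B ^ q) i i := by
      rw [sandwich, hAp]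
      simp only [Matrix.mul_apply, Fin.sum_univ_two]
      fin_cases i <;> simp
      ring
    have hB := hB₁.convexComb hB₂ ha hb hab
    have hup (B : Matrix (Fin 2) (Fin 2) ℂ) (hB : B.PosDef) :
        opNorm (sandwich p q (symmMat 1 0 1 (t ^ (2 / p))) B) ^ s ≤
          (((B ^ q) 0 0).re + t ^ 2 * ((B ^ q) 1 1).re) ^ s := by
      refine Real.rpow_le_rpow (norm_nonneg _) ?_ hs.le
      refine (opNorm_le_trace (sandwich_posDef p q hA hB)).trans_eq ?_
      rw [Matrix.trace_fin_two, hentry, hentry]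
      simp [← Complex.ofReal_pow]
    have hlow := diag_re_le_opNorm (sandwich_posDef p q hA hB) 0
    rw [hentry] at hlow
    simp only [Matrix.cons_val_zero, one_mul] at hlow
    have h1 := h.apply hs hA hA hB₁ hB₂ ha hb hab
    rw [← add_smul, hab, one_smul] at h1
    calc _ ≤ _ := Real.rpow_le_rpow (hnn _ hB 0) hlow hs.le
      _ ≤ _ := h1
      _ ≤ _ := add_le_add (mul_le_mul_of_nonneg_left (hup _ hB₁) ha)
        (mul_le_mul_of_nonneg_left (hup _ hB₂) hb)
  have hlim := nonneg_of_forall_small (f := fun t : ℝ =>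
      a * (((B₁ ^ q) 0 0).re + t ^ 2 * ((B₁ ^ q) 1 1).re) ^ s +
        b * (((B₂ ^ q) 0 0).re + t ^ 2 * ((B₂ ^ q) 1 1).re) ^ s -
        (((a • B₁ + b • B₂) ^ q) 0 0).re ^ s) (by
    refine Continuous.continuousAt ?_
    have hc (x y : ℝ) : Continuous fun t : ℝ => (x + t ^ 2 * y) ^ s :=
      Continuous.rpow_const (by fun_prop) fun _ => Or.inr hs.le
    exact (((hc _ _).const_mul a).add ((hc _ _).const_mul b)).sub continuous_const)
    fun t ht _ => sub_nonneg.2 (key t ht)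
  simpa using hlim

theorem symmMat_rpow_entry {c d x y : ℝ} (h : d ^ 2 = c * (1 - c)) (hx : 0 < x) (hy : 0 < y)
    (r : ℝ) : ((symmMat c d x y ^ r) 0 0).re = x ^ r * c + y ^ r * (1 - c) := by
  rw [symmMat_rpow h hx hy, symmMat_eq]
  simp only [Matrix.of_apply, Matrix.cons_val', Matrix.cons_val_zero, Matrix.cons_val_fin_one,
    Complex.ofReal_re]

theorem JointlyConvexOpNorm.one_le {p q s : ℝ} (hp : p ≠ 0) (hq : 0 < q) (hs : 0 < s)
    (h : JointlyConvexOpNorm 2 p q s) : 1 ≤ q := by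
  by_contra! hq1
  have hP1 : (1 / 2 : ℝ) ^ 2 = (1 / 2) * (1 - 1 / 2) := by norm_num
  have hx : (0 : ℝ) < 3 / 2 := by norm_num
  have hy : (0 : ℝ) < 1 / 2 := by norm_num
  have h1 := h.entry_convex hp hs (symmMat_posDef hP1 hx hy) (symmMat_posDef hP1 hy hx)
    (a := 1 / 2) (b := 1 / 2) (by norm_num) (by norm_num) (by norm_num)
  -- The two matrices exchange the eigenvalues `3/2` and `1/2` on the same eigenvectors, so their
  -- mean is the identity, while their powers share the diagonal entry `((3/2)^q + (1/2)^q) / 2`.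
  have e : (1 / 2 : ℝ) • symmMat (1 / 2) (1 / 2) (3 / 2) (1 / 2) +
      (1 / 2 : ℝ) • symmMat (1 / 2) (1 / 2) (1 / 2) (3 / 2) = 1 := by
    simp only [symmMat]
    module
  rw [e, CFC.one_rpow, symmMat_rpow_entry hP1 hx hy, symmMat_rpow_entry hP1 hy hx] at h1
  have hJ := (Real.strictConcaveOn_rpow hq hq1).2 hx.le hy.le
    (by norm_num) one_half_pos one_half_pos (by norm_num)
  simp only [smul_eq_mul] at hJ
  norm_num at hJ h1
  have h2 : ((3 / 2 : ℝ) ^ q * (1 / 2) + (1 / 2) ^ q * (1 / 2)) ^ s < 1 :=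
    Real.rpow_lt_one (by positivity) (by linarith) hs
  rw [add_comm ((1 / 2 : ℝ) ^ q * (1 / 2))] at h1
  linarith

theorem JointlyConvexOpNorm.le_two {p q s : ℝ} (hp : p ≠ 0) (hq : 0 < q) (hs : 0 < s)
    (h : JointlyConvexOpNorm 2 p q s) : q ≤ 2 := by
  by_contra! hq2
  have hP1 : (1 / 2 : ℝ) ^ 2 = (1 / 2) * (1 - 1 / 2) := by norm_num
  have hP2 : (2 / 5 : ℝ) ^ 2 = (4 / 5) * (1 - 4 / 5) := by norm_num
  have hP3 : (0 : ℝ) ^ 2 = 1 * (1 - 1) := by norm_num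
  -- At `t = 0` the matrix with diagonal `1, 1` and off-diagonal entry `1/2`, scaled by `θ`, is
  -- split into `θ` times the rank-one matrix with rows `(1, 1/2)`, `(1/2, 1/4)` and a multiple of
  -- `diag(0, 1)`. The latter contributes nothing to the first entry in the limit.
  have step1 (θ t : ℝ) (hθ : 0 < θ) (hθ1 : θ < 1) (ht : 0 < t) :
      ((θ * (3 / 2) + t) ^ q * (1 / 2) + (θ * (1 / 2) + t) ^ q * (1 / 2)) ^ s ≤
        θ * ((5 / 4 + t) ^ q * (4 / 5) + t ^ q * (1 / 5)) ^ s + (1 - θ) * (t ^ q) ^ s := by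
    have h1θ : 0 < 1 - θ := by linarith
    have hκ : 0 < 3 / 4 * θ / (1 - θ) + t := by positivity
    have h1 := h.entry_convex hp hs (symmMat_posDef hP2 (by positivity : 0 < 5 / 4 + t) ht)
      (symmMat_posDef hP3 ht hκ) hθ.le h1θ.le (by ring)
    have e : θ • symmMat (4 / 5) (2 / 5) (5 / 4 + t) t +
        (1 - θ) • symmMat 1 0 t (3 / 4 * θ / (1 - θ) + t) =
        symmMat (1 / 2) (1 / 2) (θ * (3 / 2) + t) (θ * (1 / 2) + t) := by
      have hc : (1 - θ : ℂ) ≠ 0 := by exact_mod_cast h1θ.ne'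
      rw [symmMat_eq, symmMat_eq, symmMat_eq]
      ext i j
      fin_cases i <;> fin_cases j <;> simp <;> field_simp <;> ring
    rw [e, symmMat_rpow_entry hP1 (by positivity) (by positivity),
      symmMat_rpow_entry hP2 (by positivity) ht, symmMat_rpow_entry hP3 ht hκ] at h1
    norm_num at h1 ⊢
    exact h1
  have hcont (x : ℝ) {e : ℝ} (he : 0 ≤ e) : Continuous fun t : ℝ => (x + t) ^ e :=
    Continuous.rpow_const (by fun_prop) fun _ => Or.inr he
  have hcont' {f : ℝ → ℝ} (hf : Continuous f) {e : ℝ} (he : 0 ≤ e) :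
      Continuous fun t : ℝ => f t ^ e :=
    hf.rpow_const fun _ => Or.inr he
  have step2 (θ : ℝ) (hθ : 0 < θ) (hθ1 : θ < 1) :
      ((θ * (3 / 2)) ^ q * (1 / 2) + (θ * (1 / 2)) ^ q * (1 / 2)) ^ s ≤
        θ * ((5 / 4) ^ q * (4 / 5)) ^ s := by
    have hlim := nonneg_of_forall_small (f := fun t : ℝ =>
      (θ * ((5 / 4 + t) ^ q * (4 / 5) + t ^ q * (1 / 5)) ^ s + (1 - θ) * (t ^ q) ^ s) -
      ((θ * (3 / 2) + t) ^ q * (1 / 2) + (θ * (1 / 2) + t) ^ q * (1 / 2)) ^ s) (by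
        refine Continuous.continuousAt (((continuous_const.mul (hcont' ?_ hs.le)).add
          (continuous_const.mul (hcont' (hcont' continuous_id hq.le) hs.le))).sub
          (hcont' ?_ hs.le))
        · exact ((hcont _ hq.le).mul continuous_const).add
            ((hcont' continuous_id hq.le).mul continuous_const)
        · exact ((hcont _ hq.le).mul continuous_const).add
            ((hcont _ hq.le).mul continuous_const)) fun t ht _ =>
        sub_nonneg.2 (step1 θ t hθ hθ1 ht)
    simpa [Real.zero_rpow hq.ne', Real.zero_rpow hs.ne'] using hlim
  -- Letting `θ → 1` yields `((3/2)^q + (1/2)^q) / 2 ≤ (4/5) (5/4)^q`, an equality at `q = 2`.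
  have step3 := nonneg_of_forall_small (f := fun t : ℝ =>
      (1 - t) * ((5 / 4) ^ q * (4 / 5)) ^ s -
      (((1 - t) * (3 / 2)) ^ q * (1 / 2) + ((1 - t) * (1 / 2)) ^ q * (1 / 2)) ^ s) (by
        refine Continuous.continuousAt ((by fun_prop : Continuous _).sub (hcont' ?_ hs.le))
        exact ((hcont' (by fun_prop) hq.le).mul continuous_const).add
            ((hcont' (by fun_prop) hq.le).mul continuous_const)) fun t ht ht1 =>
        sub_nonneg.2 (step2 (1 - t) (by linarith) (by linarith))
  simp only [sub_zero, one_mul, sub_nonneg] at step3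
  rw [Real.rpow_le_rpow_iff (by positivity) (by positivity) hs] at step3
  -- The weights `3/4`, `1/4` give mean `5/4`, and absorbing one factor of each base turns strict
  -- convexity of `x^(q-1)` into the reverse strict inequality.
  have hJ := (strictConvexOn_rpow (by linarith : 1 < q - 1)).2 
    (show (3 / 2 : ℝ) ∈ Set.Ici 0 by norm_num) (show (1 / 2 : ℝ) ∈ Set.Ici 0 by norm_num)
    (by norm_num) (show (0 : ℝ) < 3 / 4 by norm_num) (show (0 : ℝ) < 1 / 4 by norm_num)
    (by norm_num)
  simp only [smul_eq_mul] at hJ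
  rw [Real.rpow_sub_one (by norm_num), Real.rpow_sub_one (by norm_num),
    Real.rpow_sub_one (by norm_num)] at hJ
  norm_num at hJ step3
  linarith

/-! ### Monotonicity forced by concavity or convexity on a cone. -/

theorem convexComb_add_inv_smul (B B' : Matrix (Fin n) (Fin n) ℂ) {t : ℝ} (ht : 0 < t) :
    (1 - t) • B + t • (B + t⁻¹ • (B' - B)) = B' := by
  rw [smul_add, smul_smul, mul_inv_cancel₀ ht.ne']
  module

theorem rpow_neg_div_rpow {p q : ℝ} (hp : p ≠ 0) (hq : q ≠ 0) {B : Matrix (Fin n) (Fin n) ℂ}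
    (hB : B.PosDef) : (B ^ (-(q / p))) ^ (-p) = B ^ q := by
  rw [hB.rpow_rpow _ _ (neg_ne_zero.2 (div_ne_zero hq hp)), neg_mul_neg, div_mul_cancel₀ q hp]

/-- A positive concave function on the cone of positive definite matrices is monotone; for the
smallest eigenvalue this yields monotonicity of the power function. -/
theorem JointlyConcaveMinEigenvalue.rpow_le_rpow (hn : 0 < n) {p q s : ℝ} (hp : p ≠ 0)
    (hq : q ≠ 0) (hs : 0 < s) (h : JointlyConcaveMinEigenvalue n p q s)
    {B B' : Matrix (Fin n) (Fin n) ℂ} (hB : B.PosDef) (hB' : B'.PosDef) (hK : (B' - B).PosDef) :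
    B ^ q ≤ B' ^ q := by
  -- This `A` satisfies `A ^ (-p) = B ^ q`, so `B` lies on the level `1` and the level condition for
  -- `M` compares `M ^ q` with `B ^ q`.
  have hA := hB.rpow (-(q / p))
  have hAp := rpow_neg_div_rpow hp hq hB
  set A := B ^ (-(q / p))
  have level (M : Matrix (Fin n) (Fin n) ℂ) (hM : M.PosDef) :
      1 ≤ minEigenvalue (sandwich p q A M) ↔ B ^ q ≤ M ^ q := by
    rw [le_minEigenvalue_iff hn (sandwich_posDef p q hA hM).isHermitian,
      smul_one_le_sandwich_iff p q 1 hA, one_smul, hAp]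
  have hpos (M : Matrix (Fin n) (Fin n) ℂ) (hM : M.PosDef) :
      0 < minEigenvalue (sandwich p q A M) := minEigenvalue_pos hn (sandwich_posDef p q hA hM)
  rw [← level B' hB']
  -- `B'` lies between `B` and a far point `M` of the ray from `B`, with weight `t` on `M`. The
  -- value at `M` is dropped by positivity before `t → 0`.
  have hlim := nonneg_of_forall_small
    (f := fun t : ℝ => minEigenvalue (sandwich p q A B') ^ s - (1 - t)) (by fun_prop)
    fun t ht ht1 => by
      have hM := hB.add (hK.real_smul (inv_pos.2 ht))
      have h1 := h.apply hn hs hA hA hB hM (by linarith : 0 ≤ 1 - t) ht.le (by ring)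
      rw [convexComb_add_inv_smul B B' ht, ← add_smul, sub_add_cancel, one_smul] at h1
      have h2 := Real.one_le_rpow ((level B hB).2 le_rfl) hs.le
      have h3 := Real.rpow_pos_of_pos (hpos _ hM) s
      nlinarith
  by_contra! hlt
  have := Real.rpow_lt_one (hpos _ hB').le hlt hs
  simp only [sub_zero] at hlim
  linarith

theorem opNorm_rpow_le_of_neg {M : Matrix (Fin n) (Fin n) ℂ} (hM : M.PosDef) {l q : ℝ}
    (hl : 0 < l) (hlM : l • 1 ≤ M) (hq : q < 0) : opNorm (M ^ q) ≤ l ^ q := by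
  rw [← Algebra.algebraMap_eq_smul_one,
    algebraMap_le_iff_le_spectrum (ha := hM.isHermitian.isSelfAdjoint)] at hlM
  rw [opNorm_le_iff (hM.rpow q).zero_le (by positivity), ← Algebra.algebraMap_eq_smul_one,
    le_algebraMap_iff_spectrum_le (ha := (hM.rpow q).isHermitian.isSelfAdjoint),
    spectrum_rpow_real hM.zero_le]
  rintro _ ⟨x, hx, rfl⟩
  exact Real.rpow_le_rpow_of_nonpos hl (hlM x hx) hq.le

/-- A nonnegative convex function on the cone of positive definite matrices that is bounded on
translated cones is antitone; for the operator norm this yields antitonicity of the power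
function. -/
theorem JointlyConvexOpNorm.rpow_le_rpow (hn : 0 < n) {p q s : ℝ} (hp : p ≠ 0)
    (hq : q < 0) (hs : 0 < s) (h : JointlyConvexOpNorm n p q s)
    {B B' : Matrix (Fin n) (Fin n) ℂ} (hB : B.PosDef) (hB' : B'.PosDef) (hK : (B' - B).PosDef) :
    B' ^ q ≤ B ^ q := by
  have hA := hB.rpow (-(q / p))
  have hAp := rpow_neg_div_rpow hp hq.ne hB
  set A := B ^ (-(q / p))
  have level (M : Matrix (Fin n) (Fin n) ℂ) (hM : M.PosDef) :
      opNorm (sandwich p q A M) ≤ 1 ↔ M ^ q ≤ B ^ q := by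
    rw [opNorm_le_iff (sandwich_posDef p q hA hM).zero_le zero_le_one,
      sandwich_le_smul_one_iff p q 1 hA, one_smul, hAp]
  have hl := minEigenvalue_pos hn hB
  have hlB := (le_minEigenvalue_iff hn hB.isHermitian _).1 le_rfl
  set l := minEigenvalue B
  set C := opNorm (A ^ (p / 2)) * l ^ q * opNorm (A ^ (p / 2))
  -- All points of the ray dominate `l • 1`, so for `q < 0` their powers are uniformly bounded and
  -- the far point disappears in the limit.
  have hbound (t : ℝ) (ht : 0 < t) : opNorm (sandwich p q A (B + t • (B' - B))) ≤ C := by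
    have hM := hB.add (hK.real_smul ht)
    have h1 := opNorm_rpow_le_of_neg hM hl (hlB.trans
      (le_add_of_nonneg_right (hK.real_smul ht).zero_le)) hq
    have h2 : opNorm (sandwich p q A (B + t • (B' - B))) ≤ opNorm (A ^ (p / 2)) *
        opNorm ((B + t • (B' - B)) ^ q) * opNorm (A ^ (p / 2)) :=
      norm_mul₃_le (a := A ^ (p / 2))
    have h0 : 0 ≤ opNorm (A ^ (p / 2)) := norm_nonneg _
    exact h2.trans (mul_le_mul_of_nonneg_right (mul_le_mul_of_nonneg_left h1 h0) h0)
  rw [← level B' hB']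
  have hlim := nonneg_of_forall_small
    (f := fun t : ℝ => ((1 - t) + t * C ^ s) - opNorm (sandwich p q A B') ^ s) (by fun_prop)
    fun t ht ht1 => by
      have hM := hB.add (hK.real_smul (inv_pos.2 ht))
      have h1 := h.apply hs hA hA hB hM (by linarith : 0 ≤ 1 - t) ht.le (by ring)
      rw [convexComb_add_inv_smul B B' ht, ← add_smul, sub_add_cancel, one_smul] at h1
      have h2 := Real.rpow_le_one (norm_nonneg _) ((level B hB).2 le_rfl) hs.le
      have h3 := Real.rpow_le_rpow (norm_nonneg _) (hbound t⁻¹ (inv_pos.2 ht)) hs.le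
      change opNorm (sandwich p q A B) ^ s ≤ 1 at h2
      change opNorm _ ^ s ≤ _ at h3
      nlinarith
  by_contra! hlt
  have := Real.one_lt_rpow hlt hs
  simp only [sub_zero, zero_mul, add_zero] at hlim
  linarith

theorem JointlyConcaveMinEigenvalue.le_one {p q s : ℝ} (hp : p ≠ 0) (hq : q ≠ 0) (hs : 0 < s)
    (h : JointlyConcaveMinEigenvalue 2 p q s) : q ≤ 1 :=
  le_one_of_rpow_monotone fun _ _ hB hB' hK => h.rpow_le_rpow two_pos hp hq hs hB hB' hK

/-- Antitonicity of `B ↦ B ^ q` becomes monotonicity of `B ↦ B ^ (-q)` after inversion. -/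
theorem JointlyConvexOpNorm.neg_one_le {p q s : ℝ} (hp : p ≠ 0) (hq : q < 0) (hs : 0 < s)
    (h : JointlyConvexOpNorm 2 p q s) : -1 ≤ q := by
  have := le_one_of_rpow_monotone (q := -q) fun B B' hB hB' hK => by
    have := (hB'.rpow q).inv_le_inv (hB.rpow q) (h.rpow_le_rpow two_pos hp hq hs hB hB' hK)
    rwa [hB.inv_rpow, hB'.inv_rpow] at this
  linarith

/-! ### Necessary conditions from scalar matrices. -/

section Scalar

theorem smul_one_posDef {x : ℝ} (hx : 0 < x) : (x • (1 : Matrix (Fin n) (Fin n) ℂ)).PosDef :=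
  Matrix.PosDef.one.real_smul hx

theorem sandwich_smul_one (p q : ℝ) {x y : ℝ} (hx : 0 < x) (hy : 0 < y) :
    sandwich p q (x • (1 : Matrix (Fin n) (Fin n) ℂ)) (y • 1) = (x ^ p * y ^ q) • 1 := by
  rw [sandwich, Matrix.PosDef.one.smul_rpow hx, Matrix.PosDef.one.smul_rpow hy, CFC.one_rpow,
    CFC.one_rpow, smul_mul_smul_comm, smul_mul_smul_comm, one_mul, one_mul]
  congr 1
  have : x ^ p = x ^ (p / 2) * x ^ (p / 2) := by
    rw [← Real.rpow_add hx, add_halves]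
  rw [this]
  ring

theorem minEigenvalue_smul_one (hn : 0 < n) {x : ℝ} (hx : 0 < x) :
    minEigenvalue (x • (1 : Matrix (Fin n) (Fin n) ℂ)) = x := by
  have : Nonempty (Fin n) := ⟨⟨0, hn⟩⟩
  rw [minEigenvalue_smul hn Matrix.PosDef.one hx, minEigenvalue, spectrum.one_eq, csInf_singleton,
    mul_one]

theorem opNorm_smul_one (hn : 0 < n) {x : ℝ} (hx : 0 < x) :
    opNorm (x • (1 : Matrix (Fin n) (Fin n) ℂ)) = x := by
  have : Nonempty (Fin n) := ⟨⟨0, hn⟩⟩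
  have h1 : opNorm (1 : Matrix (Fin n) (Fin n) ℂ) = 1 :=
    CStarRing.norm_one (E := Matrix (Fin n) (Fin n) ℂ)
  rw [opNorm_smul _ hx, h1, mul_one]

theorem JointlyConcaveMinEigenvalue.scalar (hn : 0 < n) {p q s : ℝ} (hs : 0 < s)
    (h : JointlyConcaveMinEigenvalue n p q s) {x₁ x₂ y₁ y₂ : ℝ} (hx₁ : 0 < x₁) (hx₂ : 0 < x₂)
    (hy₁ : 0 < y₁) (hy₂ : 0 < y₂) :
    1 / 2 * (x₁ ^ p * y₁ ^ q) ^ s + 1 / 2 * (x₂ ^ p * y₂ ^ q) ^ s ≤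
      ((1 / 2 * x₁ + 1 / 2 * x₂) ^ p * (1 / 2 * y₁ + 1 / 2 * y₂) ^ q) ^ s := by
  have := h.apply hn hs (smul_one_posDef hx₁) (smul_one_posDef hx₂) (smul_one_posDef hy₁)
    (smul_one_posDef hy₂) one_half_pos.le one_half_pos.le (add_halves 1)
  simp only [smul_smul, ← add_smul] at this
  rwa [sandwich_smul_one p q hx₁ hy₁, sandwich_smul_one p q hx₂ hy₂,
    sandwich_smul_one p q (by positivity) (by positivity), minEigenvalue_smul_one hn (by positivity),
    minEigenvalue_smul_one hn (by positivity), minEigenvalue_smul_one hn (by positivity)] at this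

theorem JointlyConvexOpNorm.scalar (hn : 0 < n) {p q s : ℝ} (hs : 0 < s)
    (h : JointlyConvexOpNorm n p q s) {x₁ x₂ y₁ y₂ : ℝ} (hx₁ : 0 < x₁) (hx₂ : 0 < x₂)
    (hy₁ : 0 < y₁) (hy₂ : 0 < y₂) :
    ((1 / 2 * x₁ + 1 / 2 * x₂) ^ p * (1 / 2 * y₁ + 1 / 2 * y₂) ^ q) ^ s ≤
      1 / 2 * (x₁ ^ p * y₁ ^ q) ^ s + 1 / 2 * (x₂ ^ p * y₂ ^ q) ^ s := by
  have := h.apply hs (smul_one_posDef hx₁) (smul_one_posDef hx₂) (smul_one_posDef hy₁)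
    (smul_one_posDef hy₂) one_half_pos.le one_half_pos.le (add_halves 1)
  simp only [smul_smul, ← add_smul] at this
  rwa [sandwich_smul_one p q hx₁ hy₁, sandwich_smul_one p q hx₂ hy₂,
    sandwich_smul_one p q (by positivity) (by positivity), opNorm_smul_one hn (by positivity),
    opNorm_smul_one hn (by positivity), opNorm_smul_one hn (by positivity)] at this

theorem exponent_mem_Icc_of_concave {e : ℝ} (h : ∀ x y : ℝ, 0 < x → 0 < y →
    1 / 2 * x ^ e + 1 / 2 * y ^ e ≤ (1 / 2 * x + 1 / 2 * y) ^ e) : e ∈ Set.Icc (0 : ℝ) 1 := by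
  constructor
  · by_contra! he
    have h2 : (0 : ℝ) < (1 / 2) ^ e := by positivity
    -- This `x` has `x ^ e = 2 (1/2)^e`, so the left side is `(1/2)^e + 1/2`, whereas the right side
    -- is at most `(1/2)^e`.
    have h1 := h ((2 * (1 / 2) ^ e) ^ e⁻¹) 1 (by positivity) one_pos
    rw [Real.rpow_inv_rpow (by positivity) he.ne, Real.one_rpow] at h1
    have h3 : (1 / 2 * (2 * (1 / 2) ^ e) ^ e⁻¹ + 1 / 2 * 1) ^ e ≤ (1 / 2 : ℝ) ^ e := by
      refine Real.rpow_le_rpow_of_nonpos (by norm_num) ?_ he.le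
      have : (0 : ℝ) < (2 * (1 / 2) ^ e) ^ e⁻¹ := by positivity
      linarith
    linarith
  · by_contra! he
    have := (strictConvexOn_rpow he).2 (show (1 : ℝ) ∈ Set.Ici 0 by norm_num)
      (show (2 : ℝ) ∈ Set.Ici 0 by norm_num) (by norm_num) one_half_pos one_half_pos (add_halves 1)
    simp only [smul_eq_mul] at this
    linarith [h 1 2 one_pos two_pos]

theorem JointlyConcaveMinEigenvalue.mul_mem_Icc (hn : 0 < n) {p q s : ℝ} (hs : 0 < s)
    (h : JointlyConcaveMinEigenvalue n p q s) : p * s ∈ Set.Icc (0 : ℝ) 1 := by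
  refine exponent_mem_Icc_of_concave fun x y hx hy => ?_
  have := h.scalar hn hs hx hy one_pos one_pos
  rw [mul_one (1 / 2), add_halves, Real.one_rpow, mul_one, mul_one, mul_one, ← Real.rpow_mul hx.le,
    ← Real.rpow_mul hy.le, ← Real.rpow_mul (by positivity)] at this
  exact this

theorem JointlyConcaveMinEigenvalue.add_mul_mem_Icc (hn : 0 < n) {p q s : ℝ} (hs : 0 < s)
    (h : JointlyConcaveMinEigenvalue n p q s) : (p + q) * s ∈ Set.Icc (0 : ℝ) 1 := by
  refine exponent_mem_Icc_of_concave fun x y hx hy => ?_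
  have := h.scalar hn hs hx hy hx hy
  rw [← Real.rpow_add hx, ← Real.rpow_add hy, ← Real.rpow_add (by positivity),
    ← Real.rpow_mul hx.le, ← Real.rpow_mul hy.le, ← Real.rpow_mul (by positivity)] at this
  exact this

/-- In the limit the function vanishes at `(1, 0)` and `(0, 1)` but is positive at their midpoint.
-/
theorem not_jointlyConvex_of_pos (hn : 0 < n) {p q s : ℝ} (hp : 0 < p) (hq : 0 < q) (hs : 0 < s) :
    ¬JointlyConvexOpNorm n p q s := by
  intro h
  have hcont {f : ℝ → ℝ} (hf : Continuous f) {e : ℝ} (he : 0 < e) :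
      Continuous fun t : ℝ => f t ^ e :=
    hf.rpow_const fun _ => Or.inr he.le
  have hlim := nonneg_of_forall_small (f := fun t : ℝ =>
    (1 / 2 * (1 ^ p * t ^ q) ^ s + 1 / 2 * (t ^ p * 1 ^ q) ^ s) -
      ((1 / 2 * 1 + 1 / 2 * t) ^ p * (1 / 2 * t + 1 / 2 * 1) ^ q) ^ s) (by
      refine Continuous.continuousAt (((continuous_const.mul (hcont (continuous_const.mul
        (hcont continuous_id hq)) hs)).add (continuous_const.mul (hcont ((hcont continuous_id
        hp).mul continuous_const) hs))).sub (hcont ((hcont ?_ hp).mul (hcont ?_ hq)) hs)) <;>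
      fun_prop) fun t ht _ => sub_nonneg.2 (h.scalar hn hs one_pos ht ht one_pos)
  simp only [Real.zero_rpow hp.ne', Real.zero_rpow hq.ne', mul_zero, zero_mul,
    Real.zero_rpow hs.ne', add_zero, zero_sub] at hlim
  have : (0 : ℝ) < ((1 / 2 * 1) ^ p * (0 + 1 / 2 * 1) ^ q) ^ s := by positivity
  linarith

theorem JointlyConvexOpNorm.one_le_add_mul (hn : 0 < n) {p q s : ℝ} (hp : p < 0) (hq : 0 < q)
    (hs : 0 < s) (h : JointlyConvexOpNorm n p q s) : 1 ≤ (p + q) * s := by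
  -- Along `(x, y) = (t, t ^ ((1 - p) / q))` one has `x^p y^q = t`, so the function tends to zero at
  -- the origin despite `p < 0`. Averaging with `(1, 1)` gives `(1/2)^((p+q)s) ≤ 1/2`.
  have hk : 0 < (1 - p) / q := div_pos (by linarith) hq
  have hlim := nonneg_of_forall_small (f := fun t : ℝ =>
    (1 / 2 * t ^ s + 1 / 2) -
      ((1 / 2 * t + 1 / 2) ^ p * (1 / 2 * t ^ ((1 - p) / q) + 1 / 2) ^ q) ^ s) (by
      have h1 : ContinuousAt (fun t : ℝ => t ^ s) 0 :=
        Real.continuousAt_rpow_const _ _ (Or.inr hs.le)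
      have h2 : ContinuousAt (fun t : ℝ => t ^ ((1 - p) / q)) 0 :=
        Real.continuousAt_rpow_const _ _ (Or.inr hk.le)
      have h3 : ContinuousAt (fun t : ℝ => (1 / 2 * t + 1 / 2) ^ p) 0 :=
        ContinuousAt.rpow_const (by fun_prop) (Or.inl (by norm_num))
      have h4 : ContinuousAt (fun t : ℝ => (1 / 2 * t ^ ((1 - p) / q) + 1 / 2) ^ q) 0 :=
        ContinuousAt.rpow_const (by fun_prop) (Or.inr hq.le)
      exact ((continuousAt_const.mul h1).add continuousAt_const).sub
        ((h3.mul h4).rpow_const (Or.inr hs.le))) fun t ht _ => by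
      have := h.scalar hn hs ht one_pos (Real.rpow_pos_of_pos ht ((1 - p) / q)) one_pos
      rw [← Real.rpow_mul ht.le, div_mul_cancel₀ _ hq.ne', ← Real.rpow_add ht,
        add_sub_cancel, Real.rpow_one] at this
      simp only [Real.one_rpow, mul_one] at this
      exact sub_nonneg.2 this
  simp only [Real.zero_rpow hs.ne', Real.zero_rpow hk.ne', mul_zero, zero_add] at hlim
  rw [← Real.rpow_add (by norm_num), ← Real.rpow_mul (by norm_num)] at hlim
  have h1 : (1 / 2 : ℝ) ^ ((p + q) * s) ≤ (1 / 2 : ℝ) ^ (1 : ℝ) := by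
    rw [Real.rpow_one]
    linarith
  exact (Real.rpow_le_rpow_left_iff_of_base_lt_one (by norm_num) (by norm_num)).1 h1

end Scalar

/-! ### The parameter conditions and the final equivalences. -/

theorem concavityCondition_iff_of_pos {p q s : ℝ} (hp : p ≠ 0) (hq : q ≠ 0) (hs : 0 < s) :
    ConcavityCondition p q s ↔
      p ∈ Set.Ioc (0 : ℝ) 1 ∧ q ∈ Set.Ioc (0 : ℝ) 1 ∧ s ≤ 1 / (p + q) := by
  constructor
  · rintro (⟨h1, h2, -, h3⟩ | ⟨-, -, -, h⟩)
    · exact ⟨⟨lt_of_le_of_ne h1.1 hp.symm, h1.2⟩, ⟨lt_of_le_of_ne h2.1 hq.symm, h2.2⟩, h3⟩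
    · exact absurd h hs.not_gt
  · rintro ⟨h1, h2, h3⟩
    exact Or.inl ⟨Set.Ioc_subset_Icc_self h1, Set.Ioc_subset_Icc_self h2, hs, h3⟩

theorem concavityCondition_neg_iff (p q s : ℝ) :
    ConcavityCondition (-p) (-q) (-s) ↔ ConcavityCondition p q s := by
  have h1 : 1 / (-p + -q) = -(1 / (p + q)) := by rw [← neg_add, one_div_neg_eq_neg_one_div]
  simp only [ConcavityCondition, Set.mem_Icc, h1, neg_le_neg_iff, Left.neg_pos_iff,
    Left.neg_neg_iff, Left.nonneg_neg_iff, neg_le (a := p), neg_le (a := q),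
    neg_le_neg_iff]
  constructor <;> (rintro (h | h) <;> [right; left]) <;> refine ⟨⟨?_, ?_⟩, ⟨?_, ?_⟩, ?_, ?_⟩ <;>
    linarith [h.1.1, h.1.2, h.2.1.1, h.2.1.2, h.2.2.1, h.2.2.2]

theorem convexityCondition_neg_iff (p q s : ℝ) :
    ConvexityCondition (-p) (-q) (-s) ↔ ConvexityCondition p q s := by
  rw [ConvexityCondition, ConvexityCondition, neg_neg, neg_neg, neg_neg, or_comm]

theorem PosConvexityCondition.pos {p q s : ℝ} (h : PosConvexityCondition p q s) : 0 < s := by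
  rcases h with ⟨-, -, h⟩ | ⟨-, -, h, h'⟩ | ⟨-, -, h, h'⟩
  · exact h
  · exact lt_of_lt_of_le (one_div_pos.2 h) h'
  · exact lt_of_lt_of_le (one_div_pos.2 h) h'

theorem convexityCondition_iff_of_pos {p q s : ℝ} (hs : 0 < s) :
    ConvexityCondition p q s ↔ PosConvexityCondition p q s :=
  ⟨fun h => h.resolve_right fun h' => by linarith [h'.pos], Or.inl⟩

theorem jointlyConcave_iff_of_pos {p q s : ℝ} (hp : p ≠ 0) (hq : q ≠ 0) (hs : 0 < s) :
    (JointlyConcaveMinEigenvalue 2 p q s → ConcavityCondition p q s) ∧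
      (ConcavityCondition p q s → ∀ n : ℕ, 0 < n → JointlyConcaveMinEigenvalue n p q s) := by
  rw [concavityCondition_iff_of_pos hp hq hs]
  refine ⟨fun h => ?_, fun ⟨h1, h2, h3⟩ n hn => jointlyConcave_of_pos hn h1 h2 hs h3⟩
  have hp0 : 0 < p :=
    lt_of_le_of_ne (nonneg_of_mul_nonneg_left (h.mul_mem_Icc two_pos hs).1 hs) hp.symm
  have hq0 : 0 < q :=
    lt_of_le_of_ne (nonneg_of_mul_nonneg_left (h.swap.mul_mem_Icc two_pos hs).1 hs) hq.symm
  refine ⟨⟨hp0, h.swap.le_one hq hp hs⟩, ⟨hq0, h.le_one hp hq hs⟩, ?_⟩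
  rw [le_div_iff₀' (add_pos hp0 hq0)]
  exact (h.add_mul_mem_Icc two_pos hs).2

theorem jointlyConvex_iff_of_pos {p q s : ℝ} (hp : p ≠ 0) (hq : q ≠ 0) (hs : 0 < s) :
    (JointlyConvexOpNorm 2 p q s → ConvexityCondition p q s) ∧
      (ConvexityCondition p q s → ∀ n : ℕ, 0 < n → JointlyConvexOpNorm n p q s) := by
  rw [convexityCondition_iff_of_pos hs]
  refine ⟨fun h => ?_, ?_⟩
  · have mixed {p q : ℝ} (hp : p < 0) (hq : 0 < q) (h : JointlyConvexOpNorm 2 p q s) :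
        p ∈ Set.Icc (-1 : ℝ) 0 ∧ q ∈ Set.Icc (1 : ℝ) 2 ∧ 0 < p + q ∧ 1 / (p + q) ≤ s := by
      have h1 := h.one_le_add_mul two_pos hp hq hs
      have h2 : 0 < p + q := pos_of_mul_pos_left (by linarith) hs.le
      exact ⟨⟨h.swap.neg_one_le hq.ne' hp hs, hp.le⟩,
        ⟨h.one_le hp.ne hq hs, h.le_two hp.ne hq hs⟩, h2, (div_le_iff₀' h2).2 h1⟩
    rcases hp.lt_or_gt with hp0 | hp0 <;> rcases hq.lt_or_gt with hq0 | hq0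
    · exact Or.inl ⟨⟨h.swap.neg_one_le hq hp0 hs, hp0.le⟩, ⟨h.neg_one_le hp hq0 hs, hq0.le⟩, hs⟩
    · exact Or.inr (Or.inl (mixed hp0 hq0 h))
    · obtain ⟨h1, h2, h3, h4⟩ := mixed hq0 hp0 h.swap
      rw [add_comm] at h3 h4
      exact Or.inr (Or.inr ⟨h2, h1, h3, h4⟩)
    · exact absurd h (not_jointlyConvex_of_pos two_pos hp0 hq0 hs)
  · rintro (⟨h1, h2, -⟩ | ⟨h1, h2, h3, h4⟩ | ⟨h1, h2, h3, h4⟩) n hn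
    · exact jointlyConvex_of_neg hn h1 h2 (add_neg_of_neg_of_nonpos (lt_of_le_of_ne h1.2 hp) h2.2) hs
    · exact jointlyConvex_of_mixed hn h1 h2 h3 h4
    · rw [add_comm] at h3 h4
      exact (jointlyConvex_of_mixed hn h2 h1 h3 h4).swap

end

theorem theorem5p2 (p q s : ℝ) (hp : p ≠ 0) (hq : q ≠ 0) (hs : s ≠ 0) :
    List.TFAE [∀ n : ℕ, 0 < n → JointlyConcaveMinEigenvalue n p q s,
      JointlyConcaveMinEigenvalue 2 p q s,
      ConcavityCondition p q s] ∧
    List.TFAE [∀ n : ℕ, 0 < n → JointlyConvexOpNorm n p q s,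
      JointlyConvexOpNorm 2 p q s,
      ConvexityCondition p q s] := by
  wlog hs0 : 0 < s generalizing p q s
  · have := this (-p) (-q) (-s) (neg_ne_zero.2 hp) (neg_ne_zero.2 hq) (neg_ne_zero.2 hs)
      (neg_pos.2 (lt_of_le_of_ne (not_lt.1 hs0) hs))
    simpa only [jointlyConcave_neg_iff, jointlyConvex_neg_iff, concavityCondition_neg_iff,
      convexityCondition_neg_iff] using this
  constructor
  · tfae_have 1 → 2 := fun h => h 2 two_pos
    tfae_have 2 → 3 := (jointlyConcave_iff_of_pos hp hq hs0).1
    tfae_have 3 → 1 := (jointlyConcave_iff_of_pos hp hq hs0).2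
    tfae_finish
  · tfae_have 1 → 2 := fun h => h 2 two_pos
    tfae_have 2 → 3 := (jointlyConvex_iff_of_pos hp hq hs0).1
    tfae_have 3 → 1 := (jointlyConvex_iff_of_pos hp hq hs0).2
    tfae_finish
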